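/- **Type theories.** By a type theory we mean a formal system deriving statements $\mathcal J\,[\Gamma]$, where $\Gamma=[x_0\in A_0,\dots,x_{n-1}\in A_{n-1}(x_0,\dots,x_{n-2})]$ is a (finite, possibly empty) context and $\mathcal J$ is a judgement of one of the forms $A\in\mathrm{Type}$, $a\in A$, $A=B\in\mathrm{Type}$, $a=b\in A$. The system contains the basic structural rules of dependent type theory (variables, weakening, substitution, reflexivity, symmetry and transitivity of definitional equality of types and of terms, conversion of $a\in A$ and of $a=b\in A$ along $A=B$), definitional equality is respected by all type and term constructors, the system may contain arbitrary further constructors and rules, and $\mathcal J\,[\Gamma]$ is derivable only if each $A_i\in\mathrm{Type}\,[x_0\in A_0,\dots,x_{i-1}\in A_{i-1}]$ is derivable. It has *strong sums* if it has a type $1$ with $*\in1$ and $a=*\in 1$ for all $a\in1$, and a type constructor $\Sigma x\in A.B$ (for $A\in\mathrm{Type}$, $B\in\mathrm{Type}\,[x\in A]$) with pairing $\mathbf p ab\in\Sigma x\in A.B$ (for $a\in A$, $b\in B[a/x]$), projections $\mathbf p_0c\in A$, $\mathbf p_1c\in B[\mathbf p_0c/x]$ (for $c\in \Sigma x\in A.B$)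 and definitional equalities $\mathbf p_0(\mathbf pab)=a$, $\mathbf p_1(\mathbf pab)=b$, $\mathbf p(\mathbf p_0c)(\mathbf p_1c)=c$. It has *propositional identity types* if it has formers $\mathrm{Id},\mathbf r,\mathbf J,\mathbf H$ such that * $\mathrm{Id}_A(a,b)\in\mathrm{Type}$ for $a,b\in A$, and $\mathbf r(a)\in\mathrm{Id}_A(a,a)$ for $a\in A$; * if $C(x,y,u)\in\mathrm{Type}\,[x\in A,y\in A,u\in\mathrm{Id}_A(x,y),\Delta(x,y,u)]$, $p\in\mathrm{Id}_A(a,b)$ and $d(x)\in C(x,x,\mathbf r(x))\,[x\in A,\Delta(x,x,\mathbf r(x))]$, then $\mathbf J(a,b,p,d)\in C(a,b,p)\,[\Delta(a,b,p)]$; * if $C$ and $d$ are as before and $a\in A$, then $\mathbf H(a,d)\in\mathrm{Id}_{C(a,a,\mathbf r(a))}(\mathbf J(a,a,\mathbf r(a),d),d(a))\,[\Delta(a,a,\mathbf r(a))]$. All these rules are meant in an arbitrary ambient context; all formers commute with substitution and respect definitional equality. **Classifying category.** Its objects are the well-formed contexts, two contexts of the same length being identified if their types are definitionally equal one after the other;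 a morphism $\Delta\to\Gamma$ is a tuple of terms $t_i\in A_i(t_0,\dots,t_{i-1})\,[\Delta]$ up to definitional equality; composition is substitution. A *dependent projection* is a projection $[\Gamma,\Delta]\to\Gamma$ that drops a final segment of a context; a *fibration* is a morphism isomorphic to a dependent projection. **Tribes.** A *tribe* is a category with a terminal object and a class of morphisms, called fibrations, which contains all isomorphisms and all morphisms $X\to1$, is closed under composition, and is such that for every fibration $p:X'\to X$ and every $f:Y\to X$ there is a pullback of $p$ along $f$ that is again a fibration $Y'\to Y$. A tribe has *propositional identity types* if one can choose for every fibration $\alpha:A\to I$ a factorisation of the diagonal $A\to A\times_IA$ as a map $r:A\to P_IA$ followed by a fibration $(s,t):P_IA\to A\times_IA$ such that: 1. if $g:V\to U$ is any pullback of $r:A\to P_IA$ along a fibration $U\to P_IA$, and $f:B\to D$ is a fibration, $k:V\to B$, $l:U\to D$ with $fk=lg$, then there are $d:U\to B$ and $H:V\to P_D(B)$ with $fd=l$, $sH=dg$ and $tH=k$; 2. for every fibration $\alpha : A\to I$ and every map $\kappa:J\to I$ there are morphisms $P_J(\kappa^*A)\to\kappa^*(P_IA)$ and $\kappa^*(P_IA)\to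 P_J(\kappa^*A)$ over $\kappa^*(A\times_IA)\cong\kappa^*A\times_J\kappa^*A$. **Proposition.** The classifying category of any type theory with strong sums and propositional identity types, with the fibrations above, is a tribe with propositional identity types. -/

import Mathlib

open CategoryTheory CategoryTheory.Limits

universe u

namespace DTT

/-! ### Raw expressions

Raw types and terms are well-scoped: `Expr S .ty n` and `Expr S .tm n` are the raw types and terms
whose free variables are among `n` given ones. Variables are de Bruijn indices, so the variable
`0` is the one declared last. -/

/-- The two kinds of raw expressions: types and terms. -/
inductive Srt : Type
  | ty
  | tm

/-- `S.Op s [(s₁, b₁), …, (sₖ, bₖ)]` is the set of primitive constructors that build an expression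
of sort `s` from `k` arguments, where the `i`-th argument has sort `sᵢ` and binds `bᵢ` variables. -/
structure Signature where
  Op : Srt → List (Srt × ℕ) → Type u

/-- `ext n k = n + k`, computed so that `ext n (k + 1)` unfolds to `ext (n + 1) k`. -/
@[reducible]
def ext : ℕ → ℕ → ℕ
  | n, 0 => n
  | n, k + 1 => ext (n + 1) k

inductive Expr (S : Signature.{u}) : Srt → ℕ → Type u
  | var {n : ℕ} (i : Fin n) : Expr S Srt.tm n
  | op {s : Srt} {n : ℕ} {ar : List (Srt × ℕ)} (o : S.Op s ar)
      (args : ∀ i : Fin ar.length, Expr S (ar.get i).1 (ext n (ar.get i).2)) : Expr S s n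

abbrev Ty (S : Signature.{u}) (n : ℕ) : Type u := Expr S Srt.ty n

abbrev Tm (S : Signature.{u}) (n : ℕ) : Type u := Expr S Srt.tm n

/-- Simultaneous substitutions: an `n`-tuple of terms with free variables among `m` given ones. -/
abbrev Sub (S : Signature.{u}) (n m : ℕ) : Type u := Fin n → Tm S m

section Substitution

variable {S : Signature.{u}} {s : Srt} {n m l : ℕ}

/-- A renaming extended by one bound variable. -/
def upRen (ρ : Fin n → Fin m) : Fin (n + 1) → Fin (m + 1) :=
  Fin.cases 0 (fun i => (ρ i).succ)

/-- A renaming extended by `k` bound variables. -/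
def upRenN : {n m : ℕ} → (k : ℕ) → (Fin n → Fin m) → Fin (ext n k) → Fin (ext m k)
  | _, _, 0, ρ => ρ
  | _, _, k + 1, ρ => upRenN k (upRen ρ)

def Expr.ren : {s : Srt} → {n m : ℕ} → Expr S s n → (Fin n → Fin m) → Expr S s m
  | _, _, _, Expr.var i, ρ => Expr.var (ρ i)
  | _, _, _, Expr.op o args, ρ => Expr.op o (fun i => (args i).ren (upRenN _ ρ))

/-- Weakening of an expression by one new last variable. -/
def Expr.wk (e : Expr S s n) : Expr S s (n + 1) := e.ren Fin.succ

/-- The substitution that maps the last variable to `t` and the others according to `σ`. -/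
def Sub.cons (t : Tm S m) (σ : Sub S n m) : Sub S (n + 1) m := Fin.cases t σ

/-- The identity substitution. -/
def Sub.id (n : ℕ) : Sub S n n := Expr.var

/-- A substitution extended by one bound variable. -/
def Sub.up (σ : Sub S n m) : Sub S (n + 1) (m + 1) :=
  Sub.cons (Expr.var 0) (fun i => (σ i).wk)

/-- A substitution extended by `k` bound variables. -/
def Sub.upN : {n m : ℕ} → (k : ℕ) → Sub S n m → Sub S (ext n k) (ext m k)
  | _, _, 0, σ => σ
  | _, _, k + 1, σ => Sub.upN k (Sub.up σ)

/-- Capture-avoiding simultaneous substitution. -/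
def Expr.sub : {s : Srt} → {n m : ℕ} → Expr S s n → Sub S n m → Expr S s m
  | _, _, _, Expr.var i, σ => σ i
  | _, _, _, Expr.op o args, σ => Expr.op o (fun i => (args i).sub (Sub.upN _ σ))

/-- The substitution `[a/x]` of `a` for the last variable `x`. -/
def Sub.inst (a : Tm S n) : Sub S (n + 1) n := Sub.cons a (Sub.id n)

/-- Composition of substitutions: `(σ ⬝ τ) i = (σ i)[τ]`. -/
def Sub.comp (σ : Sub S n m) (τ : Sub S m l) : Sub S n l := fun i => (σ i).sub τ

/-! Basic facts on substitution. -/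

theorem up_ren_id : upRen (fun i : Fin n => i) = fun i => i := by
  funext i; refine Fin.cases rfl (fun _ => rfl) i

theorem upN_ren_var (k : ℕ) : ∀ {n m : ℕ} (ρ : Fin n → Fin m),
    Sub.upN k (fun i => (Expr.var (ρ i) : Tm S m)) = fun i => Expr.var (upRenN k ρ i) := by
  induction k with
  | zero => intros; rfl
  | succ k ih =>
    intro n m ρ
    have h : Sub.up (fun i => (Expr.var (ρ i) : Tm S m)) = fun i => Expr.var (upRen ρ i) := by
      funext i; refine Fin.cases rfl (fun _ => rfl) i
    change Sub.upN k (Sub.up _) = _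
    rw [h, ih]; rfl

theorem Expr.ren_eq_sub (e : Expr S s n) : ∀ {m : ℕ} (ρ : Fin n → Fin m),
    e.ren ρ = e.sub (fun i => Expr.var (ρ i)) := by
  induction e with
  | var i => intros; rfl
  | op o args ih =>
    intro m ρ
    simp only [Expr.ren, Expr.sub, upN_ren_var]
    congr 1; funext i; exact ih i _

theorem upN_id (k : ℕ) : ∀ {n : ℕ}, Sub.upN k (Sub.id (S := S) n) = Sub.id (ext n k) := by
  induction k with
  | zero => intros; rfl
  | succ k ih =>
    intro n
    have h : Sub.up (Sub.id (S := S) n) = Sub.id (n + 1) := by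
      funext i; refine Fin.cases rfl (fun _ => rfl) i
    change Sub.upN k (Sub.up _) = _
    rw [h, ih]

theorem Expr.sub_id (e : Expr S s n) : e.sub (Sub.id n) = e := by
  induction e with
  | var i => rfl
  | op o args ih =>
    simp only [Expr.sub, upN_id]
    congr 1; funext i; exact ih i

theorem upN_ren_comp (k : ℕ) : ∀ {n m l : ℕ} (ρ : Fin n → Fin m) (σ : Sub S m l),
    (fun i => Sub.upN k σ (upRenN k ρ i)) = Sub.upN k (fun i => σ (ρ i)) := by
  induction k with
  | zero => intros; rfl
  | succ k ih =>
    intro n m l ρ σ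
    change (fun i => Sub.upN k (Sub.up σ) (upRenN k (upRen ρ) i)) = Sub.upN k (Sub.up _)
    rw [ih]; congr 1; funext i; refine Fin.cases rfl (fun _ => rfl) i

theorem Expr.ren_sub (e : Expr S s n) : ∀ {m l : ℕ} (ρ : Fin n → Fin m) (σ : Sub S m l),
    (e.ren ρ).sub σ = e.sub (fun i => σ (ρ i)) := by
  induction e with
  | var i => intros; rfl
  | op o args ih =>
    intro m l ρ σ
    simp only [Expr.ren, Expr.sub]
    congr 1; funext i; rw [ih, upN_ren_comp]

theorem Expr.wk_ren (e : Expr S s n) (ρ : Fin n → Fin m) : (e.ren ρ).wk = e.wk.ren (upRen ρ) := by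
  simp only [Expr.wk]
  rw [Expr.ren_eq_sub (e.ren ρ), Expr.ren_sub, Expr.ren_eq_sub (e.ren _), Expr.ren_sub]
  rfl

theorem upN_sub_ren (k : ℕ) : ∀ {n m l : ℕ} (σ : Sub S n m) (ρ : Fin m → Fin l),
    (fun i => (Sub.upN k σ i).ren (upRenN k ρ)) = Sub.upN k (fun i => (σ i).ren ρ) := by
  induction k with
  | zero => intros; rfl
  | succ k ih =>
    intro n m l σ ρ
    change (fun i => (Sub.upN k (Sub.up σ) i).ren (upRenN k (upRen ρ))) = Sub.upN k (Sub.up _)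
    rw [ih]; congr 1; funext i
    refine Fin.cases rfl (fun j => ?_) i
    exact (Expr.wk_ren (σ j) ρ).symm

theorem Expr.sub_ren (e : Expr S s n) : ∀ {m l : ℕ} (σ : Sub S n m) (ρ : Fin m → Fin l),
    (e.sub σ).ren ρ = e.sub (fun i => (σ i).ren ρ) := by
  induction e with
  | var i => intros; rfl
  | op o args ih =>
    intro m l σ ρ
    simp only [Expr.ren, Expr.sub]
    congr 1; funext i; rw [ih, upN_sub_ren]

theorem Expr.wk_sub (e : Expr S s n) (σ : Sub S (n + 1) m) :
    e.wk.sub σ = e.sub (fun i => σ i.succ) := Expr.ren_sub e _ _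

theorem Expr.wk_sub_cons (e : Expr S s n) (t : Tm S m) (σ : Sub S n m) :
    e.wk.sub (Sub.cons t σ) = e.sub σ := Expr.wk_sub e _

theorem Expr.sub_wk (e : Expr S s n) (σ : Sub S n m) : (e.sub σ).wk = e.wk.sub (Sub.up σ) := by
  rw [Expr.wk_sub]; exact Expr.sub_ren e _ _

theorem upN_comp (k : ℕ) : ∀ {n m l : ℕ} (σ : Sub S n m) (τ : Sub S m l),
    Sub.comp (Sub.upN k σ) (Sub.upN k τ) = Sub.upN k (Sub.comp σ τ) := by
  induction k with
  | zero => intros; rfl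
  | succ k ih =>
    intro n m l σ τ
    change Sub.comp (Sub.upN k (Sub.up σ)) (Sub.upN k (Sub.up τ)) = Sub.upN k (Sub.up _)
    rw [ih]; congr 1; funext i
    refine Fin.cases rfl (fun j => ?_) i
    exact (Expr.sub_wk (σ j) τ).symm

theorem Expr.sub_sub (e : Expr S s n) : ∀ {m l : ℕ} (σ : Sub S n m) (τ : Sub S m l),
    (e.sub σ).sub τ = e.sub (Sub.comp σ τ) := by
  induction e with
  | var i => intros; rfl
  | op o args ih =>
    intro m l σ τ
    simp only [Expr.sub]
    congr 1; funext i; rw [ih, upN_comp]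

theorem Sub.up_comp_inst (σ : Sub S n m) (t : Tm S m) :
    Sub.comp (Sub.up σ) (Sub.inst t) = Sub.cons t σ := by
  funext i
  refine Fin.cases rfl (fun j => ?_) i
  change ((σ j).wk).sub (Sub.cons t (Sub.id m)) = σ j
  rw [Expr.wk_sub_cons, Expr.sub_id]

theorem Sub.cons_eta (σ : Sub S (n + 1) m) : Sub.cons (σ 0) (fun i => σ i.succ) = σ := by
  funext i; refine Fin.cases rfl (fun _ => rfl) i

end Substitution

/-! ### Contexts, judgements and derivability -/

/-- Raw contexts `[x₀ ∈ A₀, …, xₙ₋₁ ∈ Aₙ₋₁(x₀, …, xₙ₋₂)]` of length `n`. -/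
inductive Ctx (S : Signature.{u}) : ℕ → Type u
  | nil : Ctx S 0
  | snoc {n : ℕ} (Γ : Ctx S n) (A : Ty S n) : Ctx S (n + 1)

/-- Raw context extensions of length `k` of a context of length `n`. -/
inductive Tel (S : Signature.{u}) : ℕ → ℕ → Type u
  | nil {n : ℕ} : Tel S n 0
  | cons {n k : ℕ} (A : Ty S n) (Θ : Tel S (n + 1) k) : Tel S n (k + 1)

/-- Judgements with free variables among `n` given ones, in order: `A ∈ Type`, `a ∈ A`,
`A = B ∈ Type`, `a = b ∈ A`. -/
inductive Judg (S : Signature.{u}) (n : ℕ) : Type u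
  | isTy (A : Ty S n) : Judg S n
  | hasTy (a : Tm S n) (A : Ty S n) : Judg S n
  | eqTy (A B : Ty S n) : Judg S n
  | eqTm (a b : Tm S n) (A : Ty S n) : Judg S n

section Contexts

variable {S : Signature.{u}}

/-- The context `[Γ, Θ]`. -/
def Ctx.append : {n k : ℕ} → Ctx S n → Tel S n k → Ctx S (ext n k)
  | _, _, Γ, Tel.nil => Γ
  | n, _, Γ, Tel.cons A Θ => Ctx.append (n := n + 1) (Γ.snoc A) Θ

def Tel.sub : {n m k : ℕ} → Tel S n k → Sub S n m → Tel S m k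
  | _, _, _, Tel.nil, _ => Tel.nil
  | _, _, _, Tel.cons A Θ, σ => Tel.cons (A.sub σ) (Θ.sub (Sub.up σ))

def Judg.sub {n m : ℕ} : Judg S n → Sub S n m → Judg S m
  | Judg.isTy A, σ => Judg.isTy (A.sub σ)
  | Judg.hasTy a A, σ => Judg.hasTy (a.sub σ) (A.sub σ)
  | Judg.eqTy A B, σ => Judg.eqTy (A.sub σ) (B.sub σ)
  | Judg.eqTm a b A, σ => Judg.eqTm (a.sub σ) (b.sub σ) (A.sub σ)

/-- The type of the `i`-th variable of `Γ`, as a type over all variables of `Γ`. -/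
def Ctx.type : {n : ℕ} → Ctx S n → Fin n → Ty S n
  | _, Ctx.nil => Fin.elim0
  | _, Ctx.snoc Γ A => Fin.cases A.wk (fun i => (Γ.type i).wk)

/-- The substitution that forgets the last variable. -/
def Sub.proj (n : ℕ) : Sub S n (n + 1) := fun i => Expr.var i.succ

theorem Tel.sub_sub : ∀ {n k : ℕ} (Θ : Tel S n k) {m l : ℕ} (σ : Sub S n m) (τ : Sub S m l),
    (Θ.sub σ).sub τ = Θ.sub (Sub.comp σ τ) := by
  intro n k Θ
  induction Θ with
  | nil => intros; rfl
  | cons A Θ ih =>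
    intro m l σ τ
    simp only [Tel.sub, Expr.sub_sub, ih]
    congr 2
    exact upN_comp 1 σ τ

theorem Tel.sub_id : ∀ {n k : ℕ} (Θ : Tel S n k), Θ.sub (Sub.id n) = Θ := by
  intro n k Θ
  induction Θ with
  | nil => rfl
  | @cons n k A Θ ih =>
    have h : Sub.up (Sub.id (S := S) n) = Sub.id (n + 1) := upN_id 1
    simp only [Tel.sub, Expr.sub_id, h, ih]

theorem Judg.sub_sub {n m l : ℕ} (J : Judg S n) (σ : Sub S n m) (τ : Sub S m l) :
    (J.sub σ).sub τ = J.sub (Sub.comp σ τ) := by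
  cases J <;> simp only [Judg.sub, Expr.sub_sub]

theorem Judg.sub_id {n : ℕ} (J : Judg S n) : J.sub (Sub.id n) = J := by
  cases J <;> simp only [Judg.sub, Expr.sub_id]

end Contexts

/-- A statement `𝒥 [Γ]`. -/
structure Stmt (S : Signature.{u}) where
  len : ℕ
  ctx : Ctx S len
  judg : Judg S len

/-- Derivability in the formal system whose rules are those in `R` (each given by its finitely many
premises and its conclusion) and the basic rules of dependent type theory. The last two rules say
that types and terms respect definitional equality; they sum up the congruence rules for all type
and term constructors. -/
inductive Derivable {S : Signature.{u}} (R : Set (List (Stmt S) × Stmt S)) :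
    {n : ℕ} → Ctx S n → Judg S n → Prop
  | rule {ps : List (Stmt S)} {c : Stmt S} (h : (ps, c) ∈ R)
      (hps : ∀ p ∈ ps, Derivable R p.ctx p.judg) : Derivable R c.ctx c.judg
  | ax {n : ℕ} {Δ : Ctx S n} {A : Ty S n} (hA : Derivable R Δ (.isTy A)) :
      Derivable R (Δ.snoc A) (.hasTy (.var 0) A.wk)
  | weakening {n k : ℕ} {Δ : Ctx S n} {Γ : Tel S n k} {J : Judg S (ext n k)} {A : Ty S n}
      (hJ : Derivable R (Δ.append Γ) J) (hA : Derivable R Δ (.isTy A)) :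
      Derivable R ((Δ.snoc A).append (Γ.sub (Sub.proj n))) (J.sub (Sub.upN k (Sub.proj n)))
  | substitution {n k : ℕ} {Δ : Ctx S n} {A : Ty S n} {Γ : Tel S (n + 1) k}
      {J : Judg S (ext (n + 1) k)} {a : Tm S n}
      (hJ : Derivable R ((Δ.snoc A).append Γ) J) (ha : Derivable R Δ (.hasTy a A)) :
      Derivable R (Δ.append (Γ.sub (Sub.inst a))) (J.sub (Sub.upN k (Sub.inst a)))
  | ty_refl {n : ℕ} {Γ : Ctx S n} {A : Ty S n} (hA : Derivable R Γ (.isTy A)) :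
      Derivable R Γ (.eqTy A A)
  | ty_symm {n : ℕ} {Γ : Ctx S n} {A B : Ty S n} (h : Derivable R Γ (.eqTy A B)) :
      Derivable R Γ (.eqTy B A)
  | ty_trans {n : ℕ} {Γ : Ctx S n} {A B C : Ty S n} (h : Derivable R Γ (.eqTy A B))
      (h' : Derivable R Γ (.eqTy B C)) : Derivable R Γ (.eqTy A C)
  | tm_refl {n : ℕ} {Γ : Ctx S n} {a : Tm S n} {A : Ty S n} (ha : Derivable R Γ (.hasTy a A)) :
      Derivable R Γ (.eqTm a a A)
  | tm_symm {n : ℕ} {Γ : Ctx S n} {a b : Tm S n} {A : Ty S n}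
      (h : Derivable R Γ (.eqTm a b A)) : Derivable R Γ (.eqTm b a A)
  | tm_trans {n : ℕ} {Γ : Ctx S n} {a b c : Tm S n} {A : Ty S n}
      (h : Derivable R Γ (.eqTm a b A)) (h' : Derivable R Γ (.eqTm b c A)) :
      Derivable R Γ (.eqTm a c A)
  | tm_conv {n : ℕ} {Γ : Ctx S n} {a : Tm S n} {A B : Ty S n} (ha : Derivable R Γ (.hasTy a A))
      (h : Derivable R Γ (.eqTy A B)) : Derivable R Γ (.hasTy a B)
  | eq_conv {n : ℕ} {Γ : Ctx S n} {a b : Tm S n} {A B : Ty S n}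
      (hab : Derivable R Γ (.eqTm a b A)) (h : Derivable R Γ (.eqTy A B)) :
      Derivable R Γ (.eqTm a b B)
  | ty_congr {n m : ℕ} {Γ : Ctx S n} {Δ : Ctx S m} {A : Ty S n} {σ τ : Sub S n m}
      (hA : Derivable R Γ (.isTy A)) (hAσ : Derivable R Δ (.isTy (A.sub σ)))
      (hσ : ∀ i, Derivable R Δ (.hasTy (σ i) ((Γ.type i).sub σ)))
      (hτ : ∀ i, Derivable R Δ (.hasTy (τ i) ((Γ.type i).sub τ)))
      (h : ∀ i, Derivable R Δ (.eqTm (σ i) (τ i) ((Γ.type i).sub σ))) :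
      Derivable R Δ (.eqTy (A.sub σ) (A.sub τ))
  | tm_congr {n m : ℕ} {Γ : Ctx S n} {Δ : Ctx S m} {a : Tm S n} {A : Ty S n} {σ τ : Sub S n m}
      (ha : Derivable R Γ (.hasTy a A)) (haσ : Derivable R Δ (.hasTy (a.sub σ) (A.sub σ)))
      (hσ : ∀ i, Derivable R Δ (.hasTy (σ i) ((Γ.type i).sub σ)))
      (hτ : ∀ i, Derivable R Δ (.hasTy (τ i) ((Γ.type i).sub τ)))
      (h : ∀ i, Derivable R Δ (.eqTm (σ i) (τ i) ((Γ.type i).sub σ))) :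
      Derivable R Δ (.eqTm (a.sub σ) (a.sub τ) (A.sub σ))

/-- Well-formed contexts: each type is derivable in the context that precedes it. -/
inductive WfCtx {S : Signature.{u}} (R : Set (List (Stmt S) × Stmt S)) :
    {n : ℕ} → Ctx S n → Prop
  | nil : WfCtx R Ctx.nil
  | snoc {n : ℕ} {Γ : Ctx S n} {A : Ty S n} (hΓ : WfCtx R Γ) (hA : Derivable R Γ (.isTy A)) :
      WfCtx R (Γ.snoc A)

/-- A dependent type theory: a signature of type and term constructors and a set of rules, such
that statements are derivable in well-formed contexts only. -/
structure TypeTheory where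
  sig : Signature.{u}
  rules : Set (List (Stmt sig) × Stmt sig)
  ctx_wf : ∀ {n : ℕ} {Γ : Ctx sig n} {J : Judg sig n}, Derivable rules Γ J → WfCtx rules Γ

namespace TypeTheory

variable (T : TypeTheory.{u})

/-- `T.Der Γ J`: the statement `J [Γ]` is derivable in `T`. -/
abbrev Der {n : ℕ} (Γ : Ctx T.sig n) (J : Judg T.sig n) : Prop := Derivable T.rules Γ J

/-- `T.Wf Γ`: the context `Γ` is well-formed in `T`. -/
abbrev Wf {n : ℕ} (Γ : Ctx T.sig n) : Prop := WfCtx T.rules Γ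

/-! ### The classifying category -/

/-- `σ : Δ → Γ` is a context morphism: `σ i ∈ Aᵢ(σ) [Δ]` is derivable for every variable
`xᵢ ∈ Aᵢ` of `Γ`. -/
def IsSub {m n : ℕ} (Δ : Ctx T.sig m) (Γ : Ctx T.sig n) (σ : Sub T.sig n m) : Prop :=
  ∀ i, T.Der Δ (.hasTy (σ i) ((Γ.type i).sub σ))

/-- Definitional equality of context morphisms `σ, τ : Δ → Γ`. -/
def EqSub {m n : ℕ} (Δ : Ctx T.sig m) (Γ : Ctx T.sig n) (σ τ : Sub T.sig n m) : Prop :=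
  ∀ i, T.Der Δ (.eqTm (σ i) (τ i) ((Γ.type i).sub σ))

/-- Definitional equality of contexts of the same length. -/
def EqCtx : {n : ℕ} → Ctx T.sig n → Ctx T.sig n → Prop
  | _, Ctx.nil, Ctx.nil => True
  | _, Ctx.snoc Γ A, Ctx.snoc Γ' A' => EqCtx Γ Γ' ∧ T.Der Γ (.eqTy A A')

section Lemmas

variable {T} {m n l : ℕ}

theorem isSub_snoc {Δ : Ctx T.sig m} {Γ : Ctx T.sig n} {A : Ty T.sig n} {σ : Sub T.sig (n + 1) m} :
    T.IsSub Δ (Γ.snoc A) σ ↔ T.IsSub Δ Γ (fun i => σ i.succ) ∧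
      T.Der Δ (.hasTy (σ 0) (A.sub (fun i => σ i.succ))) := by
  constructor
  · intro h
    refine ⟨fun i => ?_, ?_⟩
    · have := h i.succ
      rwa [show (Γ.snoc A).type i.succ = (Γ.type i).wk from rfl, Expr.wk_sub] at this
    · have := h 0
      rwa [show (Γ.snoc A).type 0 = A.wk from rfl, Expr.wk_sub] at this
  · rintro ⟨h, h0⟩ i
    refine Fin.cases ?_ (fun j => ?_) i
    · rwa [show (Γ.snoc A).type 0 = A.wk from rfl, Expr.wk_sub]
    · rw [show (Γ.snoc A).type j.succ = (Γ.type j).wk from rfl, Expr.wk_sub]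
      exact h j

/-- Simultaneous substitution under a context extension is admissible. -/
theorem der_sub_tel {Δ : Ctx T.sig m} (hΔ : T.Wf Δ) (Γ : Ctx T.sig n) :
    ∀ {k : ℕ} (Θ : Tel T.sig n k) (J : Judg T.sig (ext n k)) (σ : Sub T.sig n m),
      T.IsSub Δ Γ σ → T.Der (Γ.append Θ) J →
      T.Der (Δ.append (Θ.sub σ)) (J.sub (Sub.upN k σ)) := by
  induction Γ with
  | nil =>
    intro k Θ J σ _ hJ
    induction hΔ with
    | nil =>
      have : σ = Sub.id 0 := funext fun i => i.elim0
      subst this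
      rwa [Tel.sub_id, upN_id, Judg.sub_id]
    | @snoc m Δ B hΔ hB ih =>
      have h := Derivable.weakening (ih (fun i => i.elim0) (fun i => i.elim0)) hB
      rw [Tel.sub_sub, Judg.sub_sub, upN_comp] at h
      have e : Sub.comp (fun i : Fin 0 => (i.elim0 : Tm T.sig m)) (Sub.proj m) = σ :=
        funext fun i => i.elim0
      rwa [e] at h
  | @snoc n Γ A ih =>
    intro k Θ J σ hσ hJ
    rw [isSub_snoc] at hσ
    have h := ih (Tel.cons A Θ) J _ hσ.1 hJ
    have h2 := Derivable.substitution (k := k) h hσ.2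
    have e : Sub.comp (Sub.up fun i => σ i.succ) (Sub.inst (σ 0)) = σ := by
      rw [Sub.up_comp_inst, Sub.cons_eta]
    rw [Tel.sub_sub, Judg.sub_sub, e] at h2
    change T.Der _ (J.sub (Sub.comp (Sub.upN k (Sub.up _)) _)) at h2
    rwa [upN_comp, e] at h2

theorem der_sub {Δ : Ctx T.sig m} (hΔ : T.Wf Δ) {Γ : Ctx T.sig n} {J : Judg T.sig n}
    {σ : Sub T.sig n m} (hσ : T.IsSub Δ Γ σ) (hJ : T.Der Γ J) : T.Der Δ (J.sub σ) :=
  der_sub_tel hΔ Γ Tel.nil J σ hσ hJ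

theorem der_wk {Δ : Ctx T.sig m} {A : Ty T.sig m} {J : Judg T.sig m} (hJ : T.Der Δ J)
    (hA : T.Der Δ (.isTy A)) : T.Der (Δ.snoc A) (J.sub (Sub.proj m)) :=
  Derivable.weakening (Γ := Tel.nil) hJ hA

theorem wk_eq_sub {s : Srt} (e : Expr T.sig s n) : e.wk = e.sub (Sub.proj n) :=
  Expr.ren_eq_sub e _

theorem isSub_wk {Δ : Ctx T.sig m} {A : Ty T.sig m} {Γ : Ctx T.sig n} {σ : Sub T.sig n m}
    (hσ : T.IsSub Δ Γ σ) (hA : T.Der Δ (.isTy A)) :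
    T.IsSub (Δ.snoc A) Γ (fun i => (σ i).wk) := by
  intro i
  have h := der_wk (hσ i) hA
  simp only [Judg.sub, ← wk_eq_sub] at h
  rwa [Expr.sub_wk, Expr.wk_sub] at h

theorem isSub_up {Δ : Ctx T.sig m} {A : Ty T.sig n} {Γ : Ctx T.sig n} {σ : Sub T.sig n m}
    (hσ : T.IsSub Δ Γ σ) (hA : T.Der Δ (.isTy (A.sub σ))) :
    T.IsSub (Δ.snoc (A.sub σ)) (Γ.snoc A) (Sub.up σ) := by
  rw [isSub_snoc]
  refine ⟨isSub_wk hσ hA, ?_⟩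
  have h := Derivable.ax hA
  rwa [Expr.sub_wk, Expr.wk_sub] at h

theorem isSub_id {Γ : Ctx T.sig n} (hΓ : T.Wf Γ) : T.IsSub Γ Γ (Sub.id n) := by
  induction hΓ with
  | nil => intro i; exact i.elim0
  | @snoc n Γ A hΓ hA ih =>
    have h := isSub_up (A := A) ih (by rwa [Expr.sub_id])
    rw [Expr.sub_id] at h
    rwa [show Sub.up (Sub.id (S := T.sig) n) = Sub.id (n + 1) from upN_id 1] at h

theorem isSub_proj {Γ : Ctx T.sig n} {A : Ty T.sig n} (h : T.Wf (Γ.snoc A)) :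
    T.IsSub (Γ.snoc A) Γ (Sub.proj n) :=
  (isSub_snoc.1 (isSub_id h)).1

theorem isSub_comp {Δ : Ctx T.sig m} {Γ : Ctx T.sig n} {Ξ : Ctx T.sig l} (hΔ : T.Wf Δ)
    {σ : Sub T.sig n m} {τ : Sub T.sig l n} (hσ : T.IsSub Δ Γ σ) (hτ : T.IsSub Γ Ξ τ) :
    T.IsSub Δ Ξ (Sub.comp τ σ) := by
  intro i
  have h := der_sub hΔ hσ (hτ i)
  simp only [Judg.sub, Expr.sub_sub] at h
  exact h

theorem wf_type {Γ : Ctx T.sig n} (hΓ : T.Wf Γ) (i : Fin n) : T.Der Γ (.isTy (Γ.type i)) := by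
  induction hΓ with
  | nil => exact i.elim0
  | @snoc n Γ A hΓ hA ih =>
    refine Fin.cases ?_ (fun j => ?_) i
    · have h := der_wk hA hA
      simp only [Judg.sub, ← wk_eq_sub] at h
      exact h
    · have h := der_wk (ih j) hA
      simp only [Judg.sub, ← wk_eq_sub] at h
      exact h

theorem ty_eqSub {Δ : Ctx T.sig m} {Γ : Ctx T.sig n} (hΔ : T.Wf Δ) {σ τ : Sub T.sig n m}
    (hσ : T.IsSub Δ Γ σ) (hτ : T.IsSub Δ Γ τ) (h : T.EqSub Δ Γ σ τ) {A : Ty T.sig n}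
    (hA : T.Der Γ (.isTy A)) : T.Der Δ (.eqTy (A.sub σ) (A.sub τ)) :=
  Derivable.ty_congr hA (der_sub hΔ hσ hA) hσ hτ h

theorem tm_eqSub {Δ : Ctx T.sig m} {Γ : Ctx T.sig n} (hΔ : T.Wf Δ) {σ τ : Sub T.sig n m}
    (hσ : T.IsSub Δ Γ σ) (hτ : T.IsSub Δ Γ τ) (h : T.EqSub Δ Γ σ τ) {a : Tm T.sig n}
    {A : Ty T.sig n} (ha : T.Der Γ (.hasTy a A)) :
    T.Der Δ (.eqTm (a.sub σ) (a.sub τ) (A.sub σ)) :=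
  Derivable.tm_congr ha (der_sub hΔ hσ ha) hσ hτ h

theorem eqSub_refl {Δ : Ctx T.sig m} {Γ : Ctx T.sig n} {σ : Sub T.sig n m}
    (hσ : T.IsSub Δ Γ σ) : T.EqSub Δ Γ σ σ := fun i => .tm_refl (hσ i)

theorem eqSub_symm {Δ : Ctx T.sig m} {Γ : Ctx T.sig n} (hΔ : T.Wf Δ) (hΓ : T.Wf Γ)
    {σ τ : Sub T.sig n m} (hσ : T.IsSub Δ Γ σ) (hτ : T.IsSub Δ Γ τ) (h : T.EqSub Δ Γ σ τ) :
    T.EqSub Δ Γ τ σ :=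
  fun i => .eq_conv (.tm_symm (h i)) (ty_eqSub hΔ hσ hτ h (wf_type hΓ i))

theorem eqSub_trans {Δ : Ctx T.sig m} {Γ : Ctx T.sig n} (hΔ : T.Wf Δ) (hΓ : T.Wf Γ)
    {σ τ υ : Sub T.sig n m} (hσ : T.IsSub Δ Γ σ) (hτ : T.IsSub Δ Γ τ) (h : T.EqSub Δ Γ σ τ)
    (h' : T.EqSub Δ Γ τ υ) : T.EqSub Δ Γ σ υ :=
  fun i => .tm_trans (h i) (.eq_conv (h' i) (.ty_symm (ty_eqSub hΔ hσ hτ h (wf_type hΓ i))))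

theorem eqSub_comp {Δ : Ctx T.sig m} {Γ : Ctx T.sig n} {Ξ : Ctx T.sig l} (hΔ : T.Wf Δ)
    (hΞ : T.Wf Ξ) {σ σ' : Sub T.sig n m} {τ τ' : Sub T.sig l n}
    (hσ : T.IsSub Δ Γ σ) (hσ' : T.IsSub Δ Γ σ') (hτ : T.IsSub Γ Ξ τ) (hτ' : T.IsSub Γ Ξ τ')
    (h : T.EqSub Δ Γ σ σ') (h' : T.EqSub Γ Ξ τ τ') :
    T.EqSub Δ Ξ (Sub.comp τ σ) (Sub.comp τ' σ') := by
  have h1 : T.EqSub Δ Ξ (Sub.comp τ σ) (Sub.comp τ' σ) := fun i => by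
    have := der_sub hΔ hσ (h' i)
    simp only [Judg.sub, Expr.sub_sub] at this
    exact this
  have h2 : T.EqSub Δ Ξ (Sub.comp τ' σ) (Sub.comp τ' σ') := fun i => by
    have := tm_eqSub hΔ hσ hσ' h (hτ' i)
    simp only [Expr.sub_sub] at this
    exact this
  exact eqSub_trans hΔ hΞ (isSub_comp hΔ hσ hτ) (isSub_comp hΔ hσ hτ') h1 h2

theorem eqCtx_isSub : ∀ {n : ℕ} {Γ Γ' : Ctx T.sig n}, T.Wf Γ → T.Wf Γ' → T.EqCtx Γ Γ' →
    T.IsSub Γ Γ' (Sub.id n) ∧ T.IsSub Γ' Γ (Sub.id n) := by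
  intro n Γ Γ' hΓ
  induction hΓ with
  | nil => intro _ _; cases Γ'; exact ⟨fun i => i.elim0, fun i => i.elim0⟩
  | @snoc n Γ A hΓ hA ih =>
    intro hΓ' h
    cases hΓ' with
    | @snoc _ Γ' A' hΓ' hA' =>
      obtain ⟨h1, h2⟩ := ih hΓ' h.1
      have key : ∀ {Δ Ξ : Ctx T.sig n} {B C : Ty T.sig n}, T.IsSub Δ Ξ (Sub.id n) →
          T.Der Δ (.isTy B) → T.Der Δ (.eqTy B C) →
          T.IsSub (Δ.snoc B) (Ξ.snoc C) (Sub.id (n + 1)) := by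
        intro Δ Ξ B C hs hB he
        rw [isSub_snoc]
        refine ⟨isSub_wk hs hB, ?_⟩
        have h3 := der_wk he hB
        simp only [Judg.sub] at h3
        have h4 := Derivable.ax hB
        rw [wk_eq_sub] at h4
        exact Derivable.tm_conv h4 h3
      refine ⟨key h1 hA h.2, key h2 hA' ?_⟩
      have h5 := der_sub hΓ' h2 (Derivable.ty_symm h.2)
      rwa [Judg.sub_id] at h5

/-- Derivability does not change when the context is replaced by a definitionally equal one. -/
theorem eqCtx_der {Γ Γ' : Ctx T.sig n} (hΓ : T.Wf Γ) (hΓ' : T.Wf Γ') (h : T.EqCtx Γ Γ')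
    (J : Judg T.sig n) : T.Der Γ J ↔ T.Der Γ' J := by
  obtain ⟨h1, h2⟩ := eqCtx_isSub hΓ hΓ' h
  constructor
  · intro hJ; have := der_sub hΓ' h2 hJ; rwa [Judg.sub_id] at this
  · intro hJ; have := der_sub hΓ h1 hJ; rwa [Judg.sub_id] at this

theorem eqCtx_refl : ∀ {n : ℕ} {Γ : Ctx T.sig n}, T.Wf Γ → T.EqCtx Γ Γ := by
  intro n Γ hΓ
  induction hΓ with
  | nil => trivial
  | snoc hΓ hA ih => exact ⟨ih, .ty_refl hA⟩

theorem eqCtx_symm : ∀ {n : ℕ} {Γ Γ' : Ctx T.sig n}, T.Wf Γ → T.Wf Γ' → T.EqCtx Γ Γ' →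
    T.EqCtx Γ' Γ := by
  intro n Γ Γ' hΓ
  induction hΓ with
  | nil => intro _ _; cases Γ'; trivial
  | @snoc n Γ A hΓ hA ih =>
    intro hΓ' h
    cases hΓ' with
    | @snoc _ Γ' A' hΓ' hA' =>
      exact ⟨ih hΓ' h.1, (eqCtx_der hΓ hΓ' h.1 _).1 (.ty_symm h.2)⟩

theorem eqCtx_trans : ∀ {n : ℕ} {Γ Γ' Γ'' : Ctx T.sig n}, T.Wf Γ → T.Wf Γ' → T.Wf Γ'' →
    T.EqCtx Γ Γ' → T.EqCtx Γ' Γ'' → T.EqCtx Γ Γ'' := by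
  intro n Γ Γ' Γ'' hΓ
  induction hΓ with
  | nil => intro _ _ _ _; cases Γ''; trivial
  | @snoc n Γ A hΓ hA ih =>
    intro hΓ' hΓ'' h h'
    cases hΓ' with
    | @snoc _ Γ' A' hΓ' hA' =>
      cases hΓ'' with
      | @snoc _ Γ'' A'' hΓ'' hA'' =>
        exact ⟨ih hΓ' hΓ'' h.1 h'.1, .ty_trans h.2 ((eqCtx_der hΓ hΓ' h.1 _).2 h'.2)⟩

theorem eqSub_cod {Δ : Ctx T.sig m} {Γ Γ' : Ctx T.sig n} (hΔ : T.Wf Δ) (hΓ : T.Wf Γ)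
    (hΓ' : T.Wf Γ') (h : T.EqCtx Γ Γ') {σ τ : Sub T.sig n m} (hσ : T.IsSub Δ Γ σ)
    (hτ : T.IsSub Δ Γ τ) (e : T.EqSub Δ Γ σ τ) : T.EqSub Δ Γ' σ τ :=
  eqSub_comp (τ := Sub.id n) (τ' := Sub.id n) hΔ hΓ' hσ hτ (eqCtx_isSub hΓ hΓ' h).1
    (eqCtx_isSub hΓ hΓ' h).1 e (eqSub_refl (eqCtx_isSub hΓ hΓ' h).1)

theorem isSub_cod {Δ : Ctx T.sig m} {Γ Γ' : Ctx T.sig n} (hΔ : T.Wf Δ) (hΓ : T.Wf Γ)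
    (hΓ' : T.Wf Γ') (h : T.EqCtx Γ Γ') {σ : Sub T.sig n m} (hσ : T.IsSub Δ Γ σ) :
    T.IsSub Δ Γ' σ :=
  isSub_comp (τ := Sub.id n) hΔ hσ (eqCtx_isSub hΓ hΓ' h).1

end Lemmas

/-- Well-formed contexts of length `n`, up to definitional equality. -/
def ctxSetoid (n : ℕ) : Setoid {Γ : Ctx T.sig n // T.Wf Γ} where
  r Γ Γ' := T.EqCtx Γ.1 Γ'.1
  iseqv :=
    ⟨fun Γ => eqCtx_refl Γ.2, fun {Γ Γ'} h => eqCtx_symm Γ.2 Γ'.2 h,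
      fun {Γ Γ' Γ''} h h' => eqCtx_trans Γ.2 Γ'.2 Γ''.2 h h'⟩

/-- The objects of the classifying category of `T`: equivalence classes of well-formed contexts of
the same length `len`. -/
structure ClassifyingCat where
  len : ℕ
  cls : Quotient (T.ctxSetoid len)

variable {T}

/-- The object of the classifying category given by a well-formed context. -/
def ob {n : ℕ} (Γ : Ctx T.sig n) (hΓ : T.Wf Γ) : T.ClassifyingCat :=
  ⟨n, Quotient.mk (T.ctxSetoid n) ⟨Γ, hΓ⟩⟩

namespace ClassifyingCat

/-- `T.IsSub` on equivalence classes of contexts. -/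
def IsSub (X Y : T.ClassifyingCat) (σ : Sub T.sig Y.len X.len) : Prop :=
  Quotient.liftOn₂ X.cls Y.cls (fun Δ Γ => T.IsSub Δ.1 Γ.1 σ) (by
    intro Δ Γ Δ' Γ' hΔ hΓ
    have h1 : T.IsSub Δ.1 Γ.1 σ ↔ T.IsSub Δ'.1 Γ.1 σ :=
      forall_congr' fun i => eqCtx_der Δ.2 Δ'.2 hΔ _
    refine propext (h1.trans ⟨?_, ?_⟩)
    · exact isSub_cod Δ'.2 Γ.2 Γ'.2 hΓ
    · exact isSub_cod Δ'.2 Γ'.2 Γ.2 (eqCtx_symm Γ.2 Γ'.2 hΓ))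

/-- The context morphisms between two classes of contexts. -/
def PreHom (X Y : T.ClassifyingCat) : Type u := {σ : Sub T.sig Y.len X.len // X.IsSub Y σ}

/-- `T.EqSub` on equivalence classes of contexts. -/
def EqSub (X Y : T.ClassifyingCat) (σ τ : PreHom X Y) : Prop :=
  Quotient.liftOn₂ X.cls Y.cls
    (fun Δ Γ => T.IsSub Δ.1 Γ.1 σ.1 ∧ T.IsSub Δ.1 Γ.1 τ.1 ∧ T.EqSub Δ.1 Γ.1 σ.1 τ.1) (by
    intro Δ Γ Δ' Γ' hΔ hΓ
    have h1 : (T.IsSub Δ.1 Γ.1 σ.1 ∧ T.IsSub Δ.1 Γ.1 τ.1 ∧ T.EqSub Δ.1 Γ.1 σ.1 τ.1) ↔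
        (T.IsSub Δ'.1 Γ.1 σ.1 ∧ T.IsSub Δ'.1 Γ.1 τ.1 ∧ T.EqSub Δ'.1 Γ.1 σ.1 τ.1) :=
      and_congr (forall_congr' fun i => eqCtx_der Δ.2 Δ'.2 hΔ _)
        (and_congr (forall_congr' fun i => eqCtx_der Δ.2 Δ'.2 hΔ _)
          (forall_congr' fun i => eqCtx_der Δ.2 Δ'.2 hΔ _))
    refine propext (h1.trans ⟨?_, ?_⟩)
    · rintro ⟨a, b, c⟩
      exact ⟨isSub_cod Δ'.2 Γ.2 Γ'.2 hΓ a, isSub_cod Δ'.2 Γ.2 Γ'.2 hΓ b,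
        eqSub_cod Δ'.2 Γ.2 Γ'.2 hΓ a b c⟩
    · have hΓ' := eqCtx_symm Γ.2 Γ'.2 hΓ
      rintro ⟨a, b, c⟩
      exact ⟨isSub_cod Δ'.2 Γ'.2 Γ.2 hΓ' a, isSub_cod Δ'.2 Γ'.2 Γ.2 hΓ' b,
        eqSub_cod Δ'.2 Γ'.2 Γ.2 hΓ' a b c⟩)

theorem ind {P : T.ClassifyingCat → Prop}
    (h : ∀ {n : ℕ} (Γ : Ctx T.sig n) (hΓ : T.Wf Γ), P (ob Γ hΓ)) (X : T.ClassifyingCat) : P X := by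
  obtain ⟨n, q⟩ := X
  induction q using Quotient.ind with
  | _ Γ => exact h Γ.1 Γ.2

theorem eqSub_ob_iff {m n : ℕ} {Δ : Ctx T.sig m} {hΔ : T.Wf Δ} {Γ : Ctx T.sig n} {hΓ : T.Wf Γ}
    (σ τ : PreHom (ob Δ hΔ) (ob Γ hΓ)) :
    EqSub _ _ σ τ ↔ T.EqSub Δ Γ σ.1 τ.1 :=
  ⟨fun h => h.2.2, fun h => ⟨σ.2, τ.2, h⟩⟩

theorem eqSub_equivalence (X Y : T.ClassifyingCat) : Equivalence (EqSub X Y) := by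
  induction X using ind with
  | _ Δ hΔ =>
  induction Y using ind with
  | _ Γ hΓ =>
  refine ⟨fun σ => ?_, fun {σ τ} h => ?_, fun {σ τ υ} h h' => ?_⟩
  · exact (eqSub_ob_iff σ σ).2 (eqSub_refl σ.2)
  · exact (eqSub_ob_iff τ σ).2 (eqSub_symm hΔ hΓ σ.2 τ.2 ((eqSub_ob_iff σ τ).1 h))
  · exact (eqSub_ob_iff σ υ).2 (eqSub_trans hΔ hΓ σ.2 τ.2 ((eqSub_ob_iff σ τ).1 h)
      ((eqSub_ob_iff τ υ).1 h'))

/-- Context morphisms up to definitional equality. -/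
def homSetoid (X Y : T.ClassifyingCat) : Setoid (PreHom X Y) := ⟨EqSub X Y, eqSub_equivalence X Y⟩

def idPre (X : T.ClassifyingCat) : PreHom X X :=
  ⟨Sub.id _, by induction X using ind with | _ Γ hΓ => exact isSub_id hΓ⟩

def compPre {X Y Z : T.ClassifyingCat} (f : PreHom X Y) (g : PreHom Y Z) : PreHom X Z :=
  ⟨Sub.comp g.1 f.1, by
    induction X using ind with
    | _ Δ hΔ =>
    induction Y using ind with
    | _ Γ hΓ =>
    induction Z using ind with
    | _ Ξ hΞ => exact isSub_comp hΔ f.2 g.2⟩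

theorem compPre_congr {X Y Z : T.ClassifyingCat} (f f' : PreHom X Y) (g g' : PreHom Y Z)
    (hf : EqSub X Y f f') (hg : EqSub Y Z g g') : EqSub X Z (compPre f g) (compPre f' g') := by
  induction X using ind with
  | _ Δ hΔ =>
  induction Y using ind with
  | _ Γ hΓ =>
  induction Z using ind with
  | _ Ξ hΞ =>
  exact (eqSub_ob_iff _ _).2 (eqSub_comp hΔ hΞ f.2 f'.2 g.2 g'.2 ((eqSub_ob_iff _ _).1 hf)
    ((eqSub_ob_iff _ _).1 hg))

instance : Category.{u} T.ClassifyingCat where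
  Hom X Y := Quotient (homSetoid X Y)
  id X := Quotient.mk _ (idPre X)
  comp {X Y Z} f g := Quotient.liftOn₂ f g (fun f g => Quotient.mk (homSetoid X Z) (compPre f g))
    (fun f g f' g' hf hg => Quotient.sound (compPre_congr f f' g g' hf hg))
  id_comp {X Y} f := by
    induction f using Quotient.ind with
    | _ f => exact congrArg (Quotient.mk _) (Subtype.ext (funext fun i => Expr.sub_id _))
  comp_id {X Y} f := by
    induction f using Quotient.ind with
    | _ f => rfl
  assoc {W X Y Z} f g h := by
    induction f using Quotient.ind with
    | _ f =>
    induction g using Quotient.ind with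
    | _ g =>
    induction h using Quotient.ind with
    | _ h =>
      exact congrArg (Quotient.mk _) (Subtype.ext (funext fun i => (Expr.sub_sub _ _ _).symm))

end ClassifyingCat

/-- The morphism of the classifying category given by a context morphism. -/
def homOf {m n : ℕ} {Δ : Ctx T.sig m} {Γ : Ctx T.sig n} (hΔ : T.Wf Δ) (hΓ : T.Wf Γ)
    (σ : Sub T.sig n m) (hσ : T.IsSub Δ Γ σ) : ob Δ hΔ ⟶ ob Γ hΓ :=
  Quotient.mk (ClassifyingCat.homSetoid (ob Δ hΔ) (ob Γ hΓ)) ⟨σ, hσ⟩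

/-- The display map `[Γ, x ∈ A] → Γ`. -/
def display {n : ℕ} {Γ : Ctx T.sig n} {A : Ty T.sig n} (hΓ : T.Wf Γ) (hA : T.Wf (Γ.snoc A)) :
    ob (Γ.snoc A) hA ⟶ ob Γ hΓ :=
  homOf hA hΓ (Sub.proj n) (isSub_proj hA)

/-- The dependent projections: the finite composites `[Γ, Δ] → Γ` of display maps. -/
inductive IsDepProj : {X Y : T.ClassifyingCat} → (X ⟶ Y) → Prop
  | id (X : T.ClassifyingCat) : IsDepProj (𝟙 X)
  | display_comp {n : ℕ} {Γ : Ctx T.sig n} {A : Ty T.sig n} (hΓ : T.Wf Γ)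
      (hA : T.Wf (Γ.snoc A)) {Y : T.ClassifyingCat} (f : ob Γ hΓ ⟶ Y) (hf : IsDepProj f) :
      IsDepProj (display hΓ hA ≫ f)

variable (T)

/-- The dependent projections as a class of morphisms. -/
def depProjections : MorphismProperty T.ClassifyingCat := fun _ _ f => IsDepProj f

/-- The fibrations of the classifying category: the morphisms that are isomorphic to a dependent
projection. -/
def fibrations : MorphismProperty T.ClassifyingCat := T.depProjections.isoClosure

/-! ### Strong sums and propositional identity types

A type or term former is an operation on raw expressions that commutes with substitution. It may
take the types that are involved as arguments, although it need not depend on them. -/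

/-- Strong unit and sum types, with congruence rules. -/
structure StrongSums where
  unit : (n : ℕ) → Ty T.sig n
  star : (n : ℕ) → Tm T.sig n
  Sig : {n : ℕ} → (A : Ty T.sig n) → (B : Ty T.sig (n + 1)) → Ty T.sig n
  pair : {n : ℕ} → (A : Ty T.sig n) → (B : Ty T.sig (n + 1)) → (a b : Tm T.sig n) → Tm T.sig n
  fst : {n : ℕ} → (A : Ty T.sig n) → (B : Ty T.sig (n + 1)) → (c : Tm T.sig n) → Tm T.sig n
  snd : {n : ℕ} → (A : Ty T.sig n) → (B : Ty T.sig (n + 1)) → (c : Tm T.sig n) → Tm T.sig n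
  -- the formers commute with substitution
  unit_sub : ∀ {n m : ℕ} (σ : Sub T.sig n m), (unit n).sub σ = unit m
  star_sub : ∀ {n m : ℕ} (σ : Sub T.sig n m), (star n).sub σ = star m
  Sig_sub : ∀ {n m : ℕ} (A : Ty T.sig n) (B : Ty T.sig (n + 1)) (σ : Sub T.sig n m),
    (Sig A B).sub σ = Sig (A.sub σ) (B.sub σ.up)
  pair_sub : ∀ {n m : ℕ} (A : Ty T.sig n) (B : Ty T.sig (n + 1)) (a b : Tm T.sig n)
    (σ : Sub T.sig n m),
    (pair A B a b).sub σ = pair (A.sub σ) (B.sub σ.up) (a.sub σ) (b.sub σ)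
  fst_sub : ∀ {n m : ℕ} (A : Ty T.sig n) (B : Ty T.sig (n + 1)) (c : Tm T.sig n)
    (σ : Sub T.sig n m), (fst A B c).sub σ = fst (A.sub σ) (B.sub σ.up) (c.sub σ)
  snd_sub : ∀ {n m : ℕ} (A : Ty T.sig n) (B : Ty T.sig (n + 1)) (c : Tm T.sig n)
    (σ : Sub T.sig n m), (snd A B c).sub σ = snd (A.sub σ) (B.sub σ.up) (c.sub σ)
  -- rules for the unit type
  unit_form : ∀ {n : ℕ} {Γ : Ctx T.sig n}, T.Wf Γ → T.Der Γ (.isTy (unit n))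
  star_intro : ∀ {n : ℕ} {Γ : Ctx T.sig n}, T.Wf Γ → T.Der Γ (.hasTy (star n) (unit n))
  unit_eta : ∀ {n : ℕ} {Γ : Ctx T.sig n} {a : Tm T.sig n}, T.Der Γ (.hasTy a (unit n)) →
    T.Der Γ (.eqTm a (star n) (unit n))
  -- rules for sum types
  Sig_form : ∀ {n : ℕ} {Γ : Ctx T.sig n} {A : Ty T.sig n} {B : Ty T.sig (n + 1)},
    T.Der Γ (.isTy A) → T.Der (Γ.snoc A) (.isTy B) → T.Der Γ (.isTy (Sig A B))
  pair_intro : ∀ {n : ℕ} {Γ : Ctx T.sig n} {A : Ty T.sig n} {B : Ty T.sig (n + 1)}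
    {a b : Tm T.sig n}, T.Der Γ (.isTy A) → T.Der (Γ.snoc A) (.isTy B) → T.Der Γ (.hasTy a A) →
    T.Der Γ (.hasTy b (B.sub (.inst a))) → T.Der Γ (.hasTy (pair A B a b) (Sig A B))
  fst_elim : ∀ {n : ℕ} {Γ : Ctx T.sig n} {A : Ty T.sig n} {B : Ty T.sig (n + 1)}
    {c : Tm T.sig n}, T.Der Γ (.isTy A) → T.Der (Γ.snoc A) (.isTy B) →
    T.Der Γ (.hasTy c (Sig A B)) → T.Der Γ (.hasTy (fst A B c) A)
  snd_elim : ∀ {n : ℕ} {Γ : Ctx T.sig n} {A : Ty T.sig n} {B : Ty T.sig (n + 1)}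
    {c : Tm T.sig n}, T.Der Γ (.isTy A) → T.Der (Γ.snoc A) (.isTy B) →
    T.Der Γ (.hasTy c (Sig A B)) → T.Der Γ (.hasTy (snd A B c) (B.sub (.inst (fst A B c))))
  fst_pair : ∀ {n : ℕ} {Γ : Ctx T.sig n} {A : Ty T.sig n} {B : Ty T.sig (n + 1)}
    {a b : Tm T.sig n}, T.Der Γ (.isTy A) → T.Der (Γ.snoc A) (.isTy B) → T.Der Γ (.hasTy a A) →
    T.Der Γ (.hasTy b (B.sub (.inst a))) → T.Der Γ (.eqTm (fst A B (pair A B a b)) a A)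
  snd_pair : ∀ {n : ℕ} {Γ : Ctx T.sig n} {A : Ty T.sig n} {B : Ty T.sig (n + 1)}
    {a b : Tm T.sig n}, T.Der Γ (.isTy A) → T.Der (Γ.snoc A) (.isTy B) → T.Der Γ (.hasTy a A) →
    T.Der Γ (.hasTy b (B.sub (.inst a))) →
    T.Der Γ (.eqTm (snd A B (pair A B a b)) b (B.sub (.inst a)))
  pair_eta : ∀ {n : ℕ} {Γ : Ctx T.sig n} {A : Ty T.sig n} {B : Ty T.sig (n + 1)}
    {c : Tm T.sig n}, T.Der Γ (.isTy A) → T.Der (Γ.snoc A) (.isTy B) →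
    T.Der Γ (.hasTy c (Sig A B)) →
    T.Der Γ (.eqTm (pair A B (fst A B c) (snd A B c)) c (Sig A B))
  -- congruence rules
  Sig_congr : ∀ {n : ℕ} {Γ : Ctx T.sig n} {A A' : Ty T.sig n} {B B' : Ty T.sig (n + 1)},
    T.Der Γ (.eqTy A A') → T.Der (Γ.snoc A) (.eqTy B B') →
    T.Der Γ (.eqTy (Sig A B) (Sig A' B'))
  pair_congr : ∀ {n : ℕ} {Γ : Ctx T.sig n} {A A' : Ty T.sig n} {B B' : Ty T.sig (n + 1)}
    {a a' b b' : Tm T.sig n}, T.Der Γ (.eqTy A A') → T.Der (Γ.snoc A) (.eqTy B B') →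
    T.Der Γ (.eqTm a a' A) → T.Der Γ (.eqTm b b' (B.sub (.inst a))) →
    T.Der Γ (.eqTm (pair A B a b) (pair A' B' a' b') (Sig A B))
  fst_congr : ∀ {n : ℕ} {Γ : Ctx T.sig n} {A A' : Ty T.sig n} {B B' : Ty T.sig (n + 1)}
    {c c' : Tm T.sig n}, T.Der Γ (.eqTy A A') → T.Der (Γ.snoc A) (.eqTy B B') →
    T.Der Γ (.eqTm c c' (Sig A B)) → T.Der Γ (.eqTm (fst A B c) (fst A' B' c') A)
  snd_congr : ∀ {n : ℕ} {Γ : Ctx T.sig n} {A A' : Ty T.sig n} {B B' : Ty T.sig (n + 1)}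
    {c c' : Tm T.sig n}, T.Der Γ (.eqTy A A') → T.Der (Γ.snoc A) (.eqTy B B') →
    T.Der Γ (.eqTm c c' (Sig A B)) →
    T.Der Γ (.eqTm (snd A B c) (snd A' B' c') (B.sub (.inst (fst A B c))))

/-- The type and term formers of propositional identity types. In `J` and `H` the variables
`x, y, u` are the last three variables of a context of length `n + 3`, and `Θ` is the context
parameter, whose `k` variables may occur in the result. -/
structure IdFormers where
  Id : {n : ℕ} → (A : Ty T.sig n) → (a b : Tm T.sig n) → Ty T.sig n
  r : {n : ℕ} → (A : Ty T.sig n) → (a : Tm T.sig n) → Tm T.sig n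
  J : {n k : ℕ} → (A : Ty T.sig n) → (Θ : Tel T.sig (n + 3) k) →
    (C : Ty T.sig (ext (n + 3) k)) → (a b p : Tm T.sig n) → (d : Tm T.sig (ext (n + 1) k)) →
    Tm T.sig (ext n k)
  H : {n k : ℕ} → (A : Ty T.sig n) → (Θ : Tel T.sig (n + 3) k) →
    (C : Ty T.sig (ext (n + 3) k)) → (a : Tm T.sig n) → (d : Tm T.sig (ext (n + 1) k)) →
    Tm T.sig (ext n k)
  Id_sub : ∀ {n m : ℕ} (A : Ty T.sig n) (a b : Tm T.sig n) (σ : Sub T.sig n m),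
    (Id A a b).sub σ = Id (A.sub σ) (a.sub σ) (b.sub σ)
  r_sub : ∀ {n m : ℕ} (A : Ty T.sig n) (a : Tm T.sig n) (σ : Sub T.sig n m),
    (r A a).sub σ = r (A.sub σ) (a.sub σ)
  J_sub : ∀ {n m k : ℕ} (A : Ty T.sig n) (Θ : Tel T.sig (n + 3) k)
    (C : Ty T.sig (ext (n + 3) k)) (a b p : Tm T.sig n) (d : Tm T.sig (ext (n + 1) k))
    (σ : Sub T.sig n m), (J A Θ C a b p d).sub (.upN k σ) =
      J (A.sub σ) (Θ.sub σ.up.up.up) (C.sub (.upN k σ.up.up.up)) (a.sub σ) (b.sub σ) (p.sub σ)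
        (d.sub (.upN k σ.up))
  H_sub : ∀ {n m k : ℕ} (A : Ty T.sig n) (Θ : Tel T.sig (n + 3) k)
    (C : Ty T.sig (ext (n + 3) k)) (a : Tm T.sig n) (d : Tm T.sig (ext (n + 1) k))
    (σ : Sub T.sig n m), (H A Θ C a d).sub (.upN k σ) =
      H (A.sub σ) (Θ.sub σ.up.up.up) (C.sub (.upN k σ.up.up.up)) (a.sub σ) (d.sub (.upN k σ.up))

variable {T}

/-- The context `[Γ, x ∈ A, y ∈ A, u ∈ Id_A(x, y)]`. -/
def IdFormers.idCtx (F : T.IdFormers) {n : ℕ} (Γ : Ctx T.sig n) (A : Ty T.sig n) :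
    Ctx T.sig (n + 3) :=
  ((Γ.snoc A).snoc A.wk).snoc (F.Id A.wk.wk (.var 1) (.var 0))

/-- The substitution `x, y, u := x, x, r(x)`. -/
def IdFormers.diag (F : T.IdFormers) {n : ℕ} (A : Ty T.sig n) : Sub T.sig (n + 3) (n + 1) :=
  .cons (F.r A.wk (.var 0)) (.cons (.var 0) (.id (n + 1)))

variable (T)

/-- The substitution `x, y, u := a, b, p`. -/
def inst₃ {n : ℕ} (a b p : Tm T.sig n) : Sub T.sig (n + 3) n :=
  .cons p (.cons b (.cons a (.id n)))

/-- Definitional equality of extensions of a context. -/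
def EqTel : {n k : ℕ} → Ctx T.sig n → Tel T.sig n k → Tel T.sig n k → Prop
  | _, _, _, .nil, .nil => True
  | _, _, Γ, .cons A Θ, .cons A' Θ' => T.Der Γ (.eqTy A A') ∧ EqTel (Γ.snoc A) Θ Θ'

/-- Propositional identity types, with congruence rules. -/
structure PropIdTypes extends T.IdFormers where
  formation : ∀ {n : ℕ} {Γ : Ctx T.sig n} {A : Ty T.sig n} {a b : Tm T.sig n},
    T.Der Γ (.isTy A) → T.Der Γ (.hasTy a A) → T.Der Γ (.hasTy b A) → T.Der Γ (.isTy (Id A a b))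
  introduction : ∀ {n : ℕ} {Γ : Ctx T.sig n} {A : Ty T.sig n} {a : Tm T.sig n},
    T.Der Γ (.isTy A) → T.Der Γ (.hasTy a A) → T.Der Γ (.hasTy (r A a) (Id A a a))
  elimination : ∀ {n k : ℕ} {Γ : Ctx T.sig n} {A : Ty T.sig n} {Θ : Tel T.sig (n + 3) k}
    {C : Ty T.sig (ext (n + 3) k)} {a b p : Tm T.sig n} {d : Tm T.sig (ext (n + 1) k)},
    T.Der ((toIdFormers.idCtx Γ A).append Θ) (.isTy C) →
    T.Der Γ (.hasTy a A) → T.Der Γ (.hasTy b A) → T.Der Γ (.hasTy p (Id A a b)) →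
    T.Der ((Γ.snoc A).append (Θ.sub (toIdFormers.diag A)))
      (.hasTy d (C.sub (.upN k (toIdFormers.diag A)))) →
    T.Der (Γ.append (Θ.sub (T.inst₃ a b p)))
      (.hasTy (J A Θ C a b p d) (C.sub (.upN k (T.inst₃ a b p))))
  computation : ∀ {n k : ℕ} {Γ : Ctx T.sig n} {A : Ty T.sig n} {Θ : Tel T.sig (n + 3) k}
    {C : Ty T.sig (ext (n + 3) k)} {a : Tm T.sig n} {d : Tm T.sig (ext (n + 1) k)},
    T.Der ((toIdFormers.idCtx Γ A).append Θ) (.isTy C) →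
    T.Der Γ (.hasTy a A) →
    T.Der ((Γ.snoc A).append (Θ.sub (toIdFormers.diag A)))
      (.hasTy d (C.sub (.upN k (toIdFormers.diag A)))) →
    T.Der (Γ.append (Θ.sub (T.inst₃ a a (r A a))))
      (.hasTy (H A Θ C a d)
        (Id (C.sub (.upN k (T.inst₃ a a (r A a)))) (J A Θ C a a (r A a) d)
          (d.sub (.upN k (.inst a)))))
  Id_congr : ∀ {n : ℕ} {Γ : Ctx T.sig n} {A A' : Ty T.sig n} {a a' b b' : Tm T.sig n},
    T.Der Γ (.eqTy A A') → T.Der Γ (.eqTm a a' A) → T.Der Γ (.eqTm b b' A) →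
    T.Der Γ (.eqTy (Id A a b) (Id A' a' b'))
  r_congr : ∀ {n : ℕ} {Γ : Ctx T.sig n} {A A' : Ty T.sig n} {a a' : Tm T.sig n},
    T.Der Γ (.eqTy A A') → T.Der Γ (.eqTm a a' A) →
    T.Der Γ (.eqTm (r A a) (r A' a') (Id A a a))
  J_congr : ∀ {n k : ℕ} {Γ : Ctx T.sig n} {A A' : Ty T.sig n} {Θ Θ' : Tel T.sig (n + 3) k}
    {C C' : Ty T.sig (ext (n + 3) k)} {a a' b b' p p' : Tm T.sig n}
    {d d' : Tm T.sig (ext (n + 1) k)},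
    T.Der Γ (.eqTy A A') → T.EqTel (toIdFormers.idCtx Γ A) Θ Θ' →
    T.Der ((toIdFormers.idCtx Γ A).append Θ) (.eqTy C C') →
    T.Der Γ (.eqTm a a' A) → T.Der Γ (.eqTm b b' A) → T.Der Γ (.eqTm p p' (Id A a b)) →
    T.Der ((Γ.snoc A).append (Θ.sub (toIdFormers.diag A)))
      (.eqTm d d' (C.sub (.upN k (toIdFormers.diag A)))) →
    T.Der (Γ.append (Θ.sub (T.inst₃ a b p)))
      (.eqTm (J A Θ C a b p d) (J A' Θ' C' a' b' p' d') (C.sub (.upN k (T.inst₃ a b p))))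
  H_congr : ∀ {n k : ℕ} {Γ : Ctx T.sig n} {A A' : Ty T.sig n} {Θ Θ' : Tel T.sig (n + 3) k}
    {C C' : Ty T.sig (ext (n + 3) k)} {a a' : Tm T.sig n} {d d' : Tm T.sig (ext (n + 1) k)},
    T.Der Γ (.eqTy A A') → T.EqTel (toIdFormers.idCtx Γ A) Θ Θ' →
    T.Der ((toIdFormers.idCtx Γ A).append Θ) (.eqTy C C') →
    T.Der Γ (.eqTm a a' A) →
    T.Der ((Γ.snoc A).append (Θ.sub (toIdFormers.diag A)))
      (.eqTm d d' (C.sub (.upN k (toIdFormers.diag A)))) →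
    T.Der (Γ.append (Θ.sub (T.inst₃ a a (r A a))))
      (.eqTm (H A Θ C a d) (H A' Θ' C' a' d')
        (Id (C.sub (.upN k (T.inst₃ a a (r A a)))) (J A Θ C a a (r A a) d)
          (d.sub (.upN k (.inst a)))))

end TypeTheory

/-! ### Tribes -/

section Tribes

universe v w

variable {C : Type w} [Category.{v} C]

/-- The category `C` with the class `F` of fibrations is a tribe. -/
structure IsTribe (F : MorphismProperty C) : Prop where
  hasTerminal : HasTerminal C
  iso_mem : ∀ {X Y : C} (f : X ⟶ Y), IsIso f → F f
  comp_mem : ∀ {X Y Z : C} (f : X ⟶ Y) (g : Y ⟶ Z), F f → F g → F (f ≫ g)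
  toTerminal_mem : ∀ {X Z : C} (_ : IsTerminal Z) (f : X ⟶ Z), F f
  pullback : ∀ {X' X Y : C} (p : X' ⟶ X) (f : Y ⟶ X), F p →
    ∃ (Y' : C) (q : Y' ⟶ Y) (f' : Y' ⟶ X'), IsPullback f' q p f ∧ F q

/-- A factorisation of the diagonal `A → A ×_I A` of `α : A → I` as a map `r : A → P_I A` followed
by a fibration `(s, t) : P_I A → A ×_I A`. -/
structure PathFactorisation (F : MorphismProperty C) {A I : C} (α : A ⟶ I) where
  P : C
  r : A ⟶ P
  s : P ⟶ A
  t : P ⟶ A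
  w : s ≫ α = t ≫ α
  r_s : r ≫ s = 𝟙 A
  r_t : r ≫ t = 𝟙 A
  fib : ∀ {Q : C} {π₁ π₂ : Q ⟶ A} (h : IsPullback π₁ π₂ α α), F (h.lift s t w)

/-- Propositional identity types in a tribe with class `F` of fibrations: a choice of `P_I A` for
all fibrations `A → I` with conditions (1) and (2). -/
def HasPropositionalIdentityTypes (F : MorphismProperty C) : Prop :=
  ∃ P : ∀ {A I : C} (α : A ⟶ I), F α → PathFactorisation F α,
    -- (1) every pullback `g : V → U` of `r : A → P_I A` along a fibration has weak fillers against
    -- every fibration `f : B → D`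
    (∀ {A I : C} (α : A ⟶ I) (hα : F α) {U V : C} (q : U ⟶ (P α hα).P) (g : V ⟶ U) (q' : V ⟶ A),
      F q → IsPullback g q' q (P α hα).r →
      ∀ {B D : C} (f : B ⟶ D) (hf : F f) (k : V ⟶ B) (l : U ⟶ D), k ≫ f = g ≫ l →
        ∃ (d : U ⟶ B) (H : V ⟶ (P f hf).P),
          d ≫ f = l ∧ H ≫ (P f hf).s = g ≫ d ∧ H ≫ (P f hf).t = k) ∧
    -- (2) if `α' : A' → J` is a pullback of `α : A → I` along `κ : J → I` and `Q → J` is a pullback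
    -- of `P_I A → I` along `κ`, with induced maps `s', t' : Q → A'`, then there are morphisms in
    -- both directions between `P_J A'` and `Q` over `A' ×_J A'`
    (∀ {A I J A' Q : C} (α : A ⟶ I) (hα : F α) (κ : J ⟶ I) (κ' : A' ⟶ A) (α' : A' ⟶ J)
      (hα' : F α') (e : Q ⟶ (P α hα).P) (β : Q ⟶ J) (s' t' : Q ⟶ A'),
      IsPullback κ' α' α κ → IsPullback e β ((P α hα).s ≫ α) κ →
      s' ≫ κ' = e ≫ (P α hα).s → s' ≫ α' = β → t' ≫ κ' = e ≫ (P α hα).t → t' ≫ α' = β →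
      (∃ φ : (P α' hα').P ⟶ Q, φ ≫ s' = (P α' hα').s ∧ φ ≫ t' = (P α' hα').t) ∧
      (∃ ψ : Q ⟶ (P α' hα').P, ψ ≫ (P α' hα').s = s' ∧ ψ ≫ (P α' hα').t = t'))

end Tribes

end DTT

/-!
With strong sums, a finite context extension is isomorphic to an extension by a single variable, so
up to isomorphism of arrows the fibrations are exactly the display maps `[Γ, x ∈ A] → Γ`, and these
pull back by substitution. The path object of a display map is the identity context
`[Γ, x ∈ A, y ∈ A, u ∈ Id_A(x, y)]`. A pullback of its reflexivity map along a fibration adds one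
variable to the context, which becomes the parameter telescope `Δ` of the elimination rule: `J` is
then the diagonal filler and `H` the homotopy. In particular reflexivity maps lift against the
fibrations `(s, t)`, which makes any two path objects of the same map comparable. Since substitution
carries identity contexts to identity contexts, path objects are stable under base change up to such
a comparison.
-/

namespace DTT

section Substitution

variable {S : Signature.{u}} {l m n : ℕ}

theorem Sub.comp_id (σ : Sub S n m) : Sub.comp σ (Sub.id m) = σ :=
  funext fun _ => Expr.sub_id _

theorem Sub.cons_var_zero_proj : Sub.cons (.var 0) (Sub.proj n) = (Sub.id (n + 1) : Sub S _ _) :=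
  Sub.cons_eta (Sub.id (n + 1))

theorem Sub.cons_comp (t : Tm S m) (σ : Sub S n m) (τ : Sub S m l) :
    Sub.comp (Sub.cons t σ) τ = Sub.cons (t.sub τ) (Sub.comp σ τ) := by
  funext i
  refine Fin.cases rfl (fun _ => rfl) i

theorem Sub.up_comp_up (σ : Sub S n m) (τ : Sub S m l) :
    Sub.comp σ.up τ.up = (Sub.comp σ τ).up :=
  upN_comp 1 σ τ

theorem Sub.up_comp_cons (σ : Sub S n m) (t : Tm S l) (τ : Sub S m l) :
    Sub.comp σ.up (Sub.cons t τ) = Sub.cons t (Sub.comp σ τ) := by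
  funext i
  refine Fin.cases rfl (fun j => ?_) i
  exact Expr.wk_sub_cons (σ j) t τ

theorem Expr.sub_up_sub_inst {s : Srt} (e : Expr S s (n + 1)) (σ : Sub S n m) (t : Tm S m) :
    (e.sub σ.up).sub (Sub.inst t) = e.sub (Sub.cons t σ) := by
  rw [Expr.sub_sub, Sub.up_comp_inst]

theorem Expr.sub_up_tail_sub_inst {s : Srt} (e : Expr S s (n + 1)) (σ : Sub S (n + 1) m) :
    (e.sub (Sub.up fun i => σ i.succ)).sub (Sub.inst (σ 0)) = e.sub σ := by
  rw [Expr.sub_up_sub_inst, Sub.cons_eta]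

theorem Sub.proj_comp_up (σ : Sub S n m) :
    Sub.comp (Sub.proj n) σ.up = Sub.comp σ (Sub.proj m) :=
  funext fun i => Expr.ren_eq_sub (σ i) _

end Substitution

namespace PathFactorisation

variable {C : Type*} [Category C] {F : MorphismProperty C} {A I A' J B D U V U' V' Q Q' : C}
  {α : A ⟶ I} {β : B ⟶ J} {f : B ⟶ D}

/-- A path factorisation whose map `(s, t)` is known to be a fibration for one choice of
`A ×_I A`. -/
def ofIsPullback [F.RespectsIso] (P : C) (r : A ⟶ P) (s t : P ⟶ A) (w : s ≫ α = t ≫ α)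
    (r_s : r ≫ s = 𝟙 A) (r_t : r ≫ t = 𝟙 A) {π₁ π₂ : Q ⟶ A} (h : IsPullback π₁ π₂ α α)
    (hF : F (h.lift s t w)) : PathFactorisation F α where
  P := P
  r := r
  s := s
  t := t
  w := w
  r_s := r_s
  r_t := r_t
  fib {Q' ρ₁ ρ₂} h' := by
    have hlift : h'.lift s t w = h.lift s t w ≫ (h.isoIsPullback A A h').hom :=
      h'.hom_ext (by simp) (by simp)
    rw [hlift]
    exact (MorphismProperty.cancel_right_of_respectsIso F _ _).2 hF

/-- Path factorisations are invariant under isomorphism of arrows. -/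
def ofIso (P : PathFactorisation F α) (a : B ≅ A) (b : J ≅ I) (h : a.hom ≫ α = β ≫ b.hom) :
    PathFactorisation F β where
  P := P.P
  r := a.hom ≫ P.r
  s := P.s ≫ a.inv
  t := P.t ≫ a.inv
  w := by
    rw [← cancel_mono b.hom]
    simp only [Category.assoc, ← h, Iso.inv_hom_id_assoc, P.w]
  r_s := by rw [Category.assoc, reassoc_of% P.r_s, Iso.hom_inv_id]
  r_t := by rw [Category.assoc, reassoc_of% P.r_t, Iso.hom_inv_id]
  fib {Q π₁ π₂} hQ := by
    have hQ' : IsPullback (π₁ ≫ a.hom) (π₂ ≫ a.hom) α α :=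
      .of_iso hQ (Iso.refl Q) a a b (by simp) (by simp) h.symm h.symm
    convert P.fib hQ' using 1
    apply hQ'.hom_ext <;> simp

/-- `g` lifts against `f`, strictly over `D` and up to a path of `P_D B` on the domain of `g`. -/
def HasWeakLifts (P : PathFactorisation F f) (g : V ⟶ U) : Prop :=
  ∀ (k : V ⟶ B) (l : U ⟶ D), k ≫ f = g ≫ l →
    ∃ (d : U ⟶ B) (H : V ⟶ P.P), d ≫ f = l ∧ H ≫ P.s = g ≫ d ∧ H ≫ P.t = k

theorem HasWeakLifts.ofIso {P : PathFactorisation F α} {g : V ⟶ U} (hP : P.HasWeakLifts g)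
    (a : B ≅ A) (b : J ≅ I) (h : a.hom ≫ α = β ≫ b.hom) : (P.ofIso a b h).HasWeakLifts g := by
  intro k l hkl
  obtain ⟨d, H, hd, hs, ht⟩ := hP (k ≫ a.hom) (l ≫ b.hom) (by
    rw [Category.assoc, h, reassoc_of% hkl])
  refine ⟨d ≫ a.inv, H, ?_, ?_, ?_⟩
  · rw [← cancel_mono b.hom, Category.assoc, Category.assoc, ← h, Iso.inv_hom_id_assoc, hd]
  · change H ≫ P.s ≫ a.inv = _
    rw [reassoc_of% hs]
  · change H ≫ P.t ≫ a.inv = _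
    rw [reassoc_of% ht, Iso.hom_inv_id, Category.comp_id]

theorem HasWeakLifts.of_arrow_iso {P : PathFactorisation F f} {g : V ⟶ U} {g' : V' ⟶ U'}
    (hP : P.HasWeakLifts g) (a : V' ≅ V) (b : U' ≅ U) (h : a.hom ≫ g = g' ≫ b.hom) :
    P.HasWeakLifts g' := by
  intro k l hkl
  obtain ⟨d, H, hd, hs, ht⟩ := hP (a.inv ≫ k) (b.inv ≫ l) (by
    rw [Category.assoc, hkl, Iso.inv_comp_eq, reassoc_of% h, Iso.hom_inv_id_assoc])
  refine ⟨b.hom ≫ d, a.hom ≫ H, ?_, ?_, ?_⟩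
  · rw [Category.assoc, hd, Iso.hom_inv_id_assoc]
  · rw [Category.assoc, hs, reassoc_of% h]
  · rw [Category.assoc, ht, Iso.hom_inv_id_assoc]

theorem exists_comparison (P P' : PathFactorisation F α) {π₁ π₂ : Q ⟶ A}
    (h : IsPullback π₁ π₂ α α) (P'' : PathFactorisation F (h.lift P'.s P'.t P'.w))
    (hlift : P''.HasWeakLifts P.r) : ∃ φ : P.P ⟶ P'.P, φ ≫ P'.s = P.s ∧ φ ≫ P'.t = P.t := by
  obtain ⟨φ, -, hφ, -⟩ := hlift P'.r (h.lift P.s P.t P.w)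
    (h.hom_ext (by simp [P.r_s, P'.r_s]) (by simp [P.r_t, P'.r_t]))
  have h₁ := congrArg (· ≫ π₁) hφ
  have h₂ := congrArg (· ≫ π₂) hφ
  simp only [Category.assoc, IsPullback.lift_fst, IsPullback.lift_snd] at h₁ h₂
  exact ⟨φ, h₁, h₂⟩

/-- `s', t' : Q ⟶ A'` is the pullback along `κ : J ⟶ I` of the path object `P_I A` with its two
endpoint maps, where `α' : A' ⟶ J` is the pullback of `α : A ⟶ I`. -/
structure IsBaseChange (P : PathFactorisation F α) (κ' : A' ⟶ A) (α' : A' ⟶ J) (κ : J ⟶ I)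
    (e : Q ⟶ P.P) (s' t' : Q ⟶ A') : Prop where
  isPullback : IsPullback κ' α' α κ
  isPullback_path : IsPullback e (s' ≫ α') (P.s ≫ α) κ
  w : s' ≫ α' = t' ≫ α'
  s_comp : s' ≫ κ' = e ≫ P.s
  t_comp : t' ≫ κ' = e ≫ P.t

namespace IsBaseChange

variable {P : PathFactorisation F α} {κ' : A' ⟶ A} {α' : A' ⟶ J} {κ : J ⟶ I}

theorem exists_iso {e : Q ⟶ P.P} {s t : Q ⟶ A'} {e' : Q' ⟶ P.P} {s' t' : Q' ⟶ A'}
    (h : P.IsBaseChange κ' α' κ e s t) (h' : P.IsBaseChange κ' α' κ e' s' t') :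
    ∃ E : Q ≅ Q', E.hom ≫ s' = s ∧ E.hom ≫ t' = t := by
  let E := h.isPullback_path.isoIsPullback _ _ h'.isPullback_path
  have hE : E.hom ≫ e' = e := h.isPullback_path.isoIsPullback_hom_fst _ _ h'.isPullback_path
  have hE' : E.hom ≫ s' ≫ α' = s ≫ α' :=
    h.isPullback_path.isoIsPullback_hom_snd _ _ h'.isPullback_path
  refine ⟨E, h.isPullback.hom_ext ?_ ?_, h.isPullback.hom_ext ?_ ?_⟩
  · rw [Category.assoc, h'.s_comp, reassoc_of% hE, h.s_comp]
  · rw [Category.assoc, hE']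
  · rw [Category.assoc, h'.t_comp, reassoc_of% hE, h.t_comp]
  · rw [Category.assoc, ← h'.w, hE', h.w]

theorem ofIso {e : Q ⟶ P.P} {s t : Q ⟶ A'} (h : P.IsBaseChange κ' α' κ e s t) {B' : C}
    {β : B ⟶ D} {β' : B' ⟶ J} {μ' : B' ⟶ B} {μ : J ⟶ D} (a : B ≅ A) (b : D ≅ I)
    (hβ : a.hom ≫ α = β ≫ b.hom) (a' : B' ≅ A') (hβ' : a'.hom ≫ α' = β')
    (hμ' : a'.hom ≫ κ' = μ' ≫ a.hom) (hμ : μ ≫ b.hom = κ) :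
    (P.ofIso a b hβ).IsBaseChange μ' β' μ e (s ≫ a'.inv) (t ≫ a'.inv) := by
  subst hβ' hμ
  have hβi : a.inv ≫ β = α ≫ b.inv := by
    rw [Iso.inv_comp_eq, reassoc_of% hβ, Iso.hom_inv_id, Category.comp_id]
  have hμi : a'.inv ≫ μ' = κ' ≫ a.inv := by
    rw [Iso.inv_comp_eq, reassoc_of% hμ', Iso.hom_inv_id, Category.comp_id]
  refine ⟨?_, ?_, ?_, ?_, ?_⟩
  · exact .of_iso h.isPullback a'.symm a.symm (Iso.refl J) b.symm hμi.symm (by simp) hβi.symm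
      (by simp)
  · refine .of_iso h.isPullback_path (Iso.refl Q) (Iso.refl P.P) (Iso.refl J) b.symm
      ((Category.comp_id e).trans (Category.id_comp e).symm) (by simp) ?_ (by simp)
    change (P.s ≫ α) ≫ b.inv = 𝟙 P.P ≫ (P.s ≫ a.inv) ≫ β
    rw [Category.id_comp, Category.assoc, Category.assoc, hβi]
  · simp [h.w]
  · rw [Category.assoc, hμi, reassoc_of% h.s_comp]
    rfl
  · rw [Category.assoc, hμi, reassoc_of% h.t_comp]
    rfl

end IsBaseChange

end PathFactorisation

namespace TypeTheory

variable {T : TypeTheory.{u}} {l m n : ℕ}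

section ContextMorphisms

variable {Γ : Ctx T.sig n} {Δ : Ctx T.sig m} {A : Ty T.sig n}

theorem Wf.init (hA : T.Wf (Γ.snoc A)) : T.Wf Γ := by
  cases hA; assumption

theorem Wf.isTy (hA : T.Wf (Γ.snoc A)) : T.Der Γ (.isTy A) := by
  cases hA; assumption

theorem Wf.isTy_wk (hA : T.Wf (Γ.snoc A)) : T.Der (Γ.snoc A) (.isTy A.wk) := by
  rw [wk_eq_sub]
  exact der_wk hA.isTy hA.isTy

theorem Wf.snoc_wk (hA : T.Wf (Γ.snoc A)) : T.Wf ((Γ.snoc A).snoc A.wk) :=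
  .snoc hA hA.isTy_wk

theorem Wf.hasTy_var (hΓ : T.Wf Γ) (i : Fin n) : T.Der Γ (.hasTy (.var i) (Γ.type i)) := by
  have h := isSub_id hΓ i
  rwa [Expr.sub_id] at h

theorem Wf.snoc_sub {σ : Sub T.sig n m} (hA : T.Wf (Γ.snoc A)) (hΔ : T.Wf Δ)
    (hσ : T.IsSub Δ Γ σ) : T.Wf (Δ.snoc (A.sub σ)) :=
  .snoc hΔ (der_sub hΔ hσ hA.isTy)

theorem IsSub.cons {σ : Sub T.sig n m} {a : Tm T.sig m} (hσ : T.IsSub Δ Γ σ)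
    (ha : T.Der Δ (.hasTy a (A.sub σ))) : T.IsSub Δ (Γ.snoc A) (Sub.cons a σ) :=
  isSub_snoc.2 ⟨hσ, ha⟩

theorem IsSub.up_of_eq {B : Ty T.sig m} {σ : Sub T.sig n m} (hσ : T.IsSub Δ Γ σ)
    (hB : T.Wf (Δ.snoc B)) (e : B = A.sub σ) : T.IsSub (Δ.snoc B) (Γ.snoc A) σ.up := by
  subst e
  exact isSub_up hσ hB.isTy

theorem eqSub_snoc {σ τ : Sub T.sig (n + 1) m} :
    T.EqSub Δ (Γ.snoc A) σ τ ↔ T.EqSub Δ Γ (fun i => σ i.succ) (fun i => τ i.succ) ∧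
      T.Der Δ (.eqTm (σ 0) (τ 0) (A.sub (fun i => σ i.succ))) := by
  simp only [EqSub, Fin.forall_fin_succ (n := n), Ctx.type, Fin.cases_zero, Fin.cases_succ,
    Expr.wk_sub]
  exact and_comm

end ContextMorphisms

section Homs

variable {Γ : Ctx T.sig n} {Δ : Ctx T.sig m} {hΓ : T.Wf Γ} {hΔ : T.Wf Δ}

theorem exists_eq_homOf (f : ob Δ hΔ ⟶ ob Γ hΓ) : ∃ σ, ∃ hσ : T.IsSub Δ Γ σ,
    f = homOf hΔ hΓ σ hσ := by
  induction f using Quotient.ind with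
  | _ f => exact ⟨f.1, f.2, rfl⟩

theorem homOf_eq_homOf_iff {σ τ : Sub T.sig n m} {hσ : T.IsSub Δ Γ σ} {hτ : T.IsSub Δ Γ τ} :
    homOf hΔ hΓ σ hσ = homOf hΔ hΓ τ hτ ↔ T.EqSub Δ Γ σ τ :=
  Quotient.eq.trans (ClassifyingCat.eqSub_ob_iff _ _)

theorem homOf_congr {σ τ : Sub T.sig n m} {hσ : T.IsSub Δ Γ σ} {hτ : T.IsSub Δ Γ τ} (h : σ = τ) :
    homOf hΔ hΓ σ hσ = homOf hΔ hΓ τ hτ := by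
  subst h; rfl

end Homs

section DisplayMaps

variable {Γ : Ctx T.sig n} {Δ : Ctx T.sig m} {Ξ : Ctx T.sig l} {A : Ty T.sig n}
  {B : Ty T.sig m} {σ : Sub T.sig n m} {hA : T.Wf (Γ.snoc A)} {hB : T.Wf (Δ.snoc B)}

theorem homOf_up_comp_display (hσ : T.IsSub Δ Γ σ) (e : B = A.sub σ) :
    homOf hB hA σ.up (hσ.up_of_eq hB e) ≫ display hA.init hA =
      display hB.init hB ≫ homOf hB.init hA.init σ hσ :=
  homOf_congr (Sub.proj_comp_up σ)

theorem exists_eq_homOf_cons {hΔ : T.Wf Δ} {f : ob Δ hΔ ⟶ ob (Γ.snoc A) hA}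
    (hσ : T.IsSub Δ Γ σ) (h : f ≫ display hA.init hA = homOf hΔ hA.init σ hσ) :
    ∃ a, ∃ ha : T.Der Δ (.hasTy a (A.sub σ)), f = homOf hΔ hA (Sub.cons a σ) (hσ.cons ha) := by
  obtain ⟨φ, hφ, rfl⟩ := exists_eq_homOf f
  obtain ⟨hφ', hφ₀⟩ := isSub_snoc.1 hφ
  have h' : T.EqSub Δ Γ (fun i => φ i.succ) σ := homOf_eq_homOf_iff.1 h
  exact ⟨φ 0, .tm_conv hφ₀ (ty_eqSub hΔ hφ' hσ h' hA.isTy),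
    homOf_eq_homOf_iff.2 (eqSub_snoc.2 ⟨h', .tm_refl hφ₀⟩)⟩

theorem exists_lift_homOf_up (hσ : T.IsSub Δ Γ σ) (e : B = A.sub σ) {hΞ : T.Wf Ξ}
    (f : ob Ξ hΞ ⟶ ob (Γ.snoc A) hA) (g : ob Ξ hΞ ⟶ ob Δ hB.init)
    (h : f ≫ display hA.init hA = g ≫ homOf hB.init hA.init σ hσ) :
    ∃ c : ob Ξ hΞ ⟶ ob (Δ.snoc B) hB,
      c ≫ homOf hB hA σ.up (hσ.up_of_eq hB e) = f ∧ c ≫ display hB.init hB = g := by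
  subst e
  obtain ⟨γ, hγ, rfl⟩ := exists_eq_homOf g
  obtain ⟨a, ha, rfl⟩ := exists_eq_homOf_cons (isSub_comp hΞ hγ hσ) h
  exact ⟨homOf hΞ hB (Sub.cons a γ) (hγ.cons (by rwa [Expr.sub_sub])),
    homOf_congr (Sub.up_comp_cons σ a γ), rfl⟩

theorem homOf_up_display_hom_ext (hσ : T.IsSub Δ Γ σ) (e : B = A.sub σ) {hΞ : T.Wf Ξ}
    {f g : ob Ξ hΞ ⟶ ob (Δ.snoc B) hB}
    (h₁ : f ≫ homOf hB hA σ.up (hσ.up_of_eq hB e) = g ≫ homOf hB hA σ.up (hσ.up_of_eq hB e))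
    (h₂ : f ≫ display hB.init hB = g ≫ display hB.init hB) : f = g := by
  subst e
  obtain ⟨φ, hφ, rfl⟩ := exists_eq_homOf f
  obtain ⟨γ, hγ, rfl⟩ := exists_eq_homOf g
  refine homOf_eq_homOf_iff.2 (eqSub_snoc.2 ⟨homOf_eq_homOf_iff.1 h₂, ?_⟩)
  rw [Expr.sub_sub]
  have h₀ : T.EqSub Ξ (Γ.snoc A) (Sub.comp σ.up φ) (Sub.comp σ.up γ) := homOf_eq_homOf_iff.1 h₁
  have hσφ : (fun i : Fin n => Sub.comp σ.up φ i.succ) = Sub.comp σ fun i => φ i.succ :=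
    funext fun i => Expr.wk_sub (σ i) φ
  have h₀' := (eqSub_snoc.1 h₀).2
  rwa [hσφ] at h₀'

theorem isPullback_display (hσ : T.IsSub Δ Γ σ) (e : B = A.sub σ) :
    IsPullback (homOf hB hA σ.up (hσ.up_of_eq hB e)) (display hB.init hB) (display hA.init hA)
      (homOf hB.init hA.init σ hσ) := by
  refine .mk' (homOf_up_comp_display hσ e) (fun W f g h₁ h₂ => ?_) fun W f g h => ?_
  all_goals
    induction W using ClassifyingCat.ind with
    | _ Ξ hΞ => ?_
  · exact homOf_up_display_hom_ext hσ e h₁ h₂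
  · exact exists_lift_homOf_up hσ e f g h

end DisplayMaps

namespace StrongSums

variable (hS : T.StrongSums) {Γ : Ctx T.sig n} {Δ : Ctx T.sig m} {A : Ty T.sig n}
  {B : Ty T.sig (n + 1)}

theorem exists_iso_snoc_unit (hΓ : T.Wf Γ) :
    ∃ (h : T.Wf (Γ.snoc (hS.unit n))) (e : ob Γ hΓ ≅ ob (Γ.snoc (hS.unit n)) h),
      e.hom ≫ display hΓ h = 𝟙 _ := by
  have hu := hS.unit_form hΓ
  have h : T.Wf (Γ.snoc (hS.unit n)) := .snoc hΓ hu
  have hstar : T.IsSub Γ (Γ.snoc (hS.unit n)) (Sub.cons (hS.star n) (Sub.id n)) :=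
    (isSub_id hΓ).cons (by rw [Expr.sub_id]; exact hS.star_intro hΓ)
  have hvar : T.Der (Γ.snoc (hS.unit n)) (.hasTy (.var 0) (hS.unit (n + 1))) := by
    simpa only [wk_eq_sub, hS.unit_sub] using Derivable.ax hu
  have heta : T.EqSub (Γ.snoc (hS.unit n)) (Γ.snoc (hS.unit n)) (Sub.id (n + 1))
      (Sub.comp (Sub.cons (hS.star n) (Sub.id n)) (Sub.proj n)) := by
    rw [Sub.cons_comp, hS.star_sub]
    refine eqSub_snoc.2 ⟨eqSub_refl (isSub_proj h), ?_⟩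
    rw [hS.unit_sub]
    exact hS.unit_eta hvar
  exact ⟨h, ⟨homOf hΓ h _ hstar, display hΓ h, rfl, (homOf_eq_homOf_iff.2 heta).symm⟩, rfl⟩

variable (A B) in
/-- Pairing of the last two entries, turning a morphism into `[Γ, x ∈ A, y ∈ B]` into a morphism
into `[Γ, z ∈ Σ x ∈ A. B]`. -/
def pairSub (τ : Sub T.sig (n + 2) m) : Sub T.sig (n + 1) m :=
  Sub.cons (hS.pair (A.sub fun i => τ i.succ.succ) (B.sub (Sub.up fun i => τ i.succ.succ))
    (τ 1) (τ 0)) fun i => τ i.succ.succ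

variable (A B) in
/-- Inverse to `pairSub`: the last entry is replaced by its two projections. -/
def unpairSub (τ : Sub T.sig (n + 1) m) : Sub T.sig (n + 2) m :=
  Sub.cons (hS.snd (A.sub fun i => τ i.succ) (B.sub (Sub.up fun i => τ i.succ)) (τ 0))
    (Sub.cons (hS.fst (A.sub fun i => τ i.succ) (B.sub (Sub.up fun i => τ i.succ)) (τ 0))
      fun i => τ i.succ)

theorem comp_pairSub (τ : Sub T.sig (n + 2) m) (ρ : Sub T.sig m l) :
    Sub.comp (hS.pairSub A B τ) ρ = hS.pairSub A B (Sub.comp τ ρ) := by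
  rw [pairSub, Sub.cons_comp, hS.pair_sub, Expr.sub_sub, Expr.sub_sub, Sub.up_comp_up]
  rfl

theorem comp_unpairSub (τ : Sub T.sig (n + 1) m) (ρ : Sub T.sig m l) :
    Sub.comp (hS.unpairSub A B τ) ρ = hS.unpairSub A B (Sub.comp τ ρ) := by
  rw [unpairSub, Sub.cons_comp, Sub.cons_comp, hS.fst_sub, hS.snd_sub, Expr.sub_sub, Expr.sub_sub,
    Sub.up_comp_up]
  rfl

section

variable (hΔ : T.Wf Δ) (hB : T.Wf ((Γ.snoc A).snoc B))
include hΔ hB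

theorem isTy_sub_up {σ : Sub T.sig n m} (hσ : T.IsSub Δ Γ σ) :
    T.Der (Δ.snoc (A.sub σ)) (.isTy (B.sub σ.up)) :=
  (hB.snoc_sub (hB.init.snoc_sub hΔ hσ) (hσ.up_of_eq (hB.init.snoc_sub hΔ hσ) rfl)).isTy

theorem isSub_pairSub {τ : Sub T.sig (n + 2) m} (hτ : T.IsSub Δ ((Γ.snoc A).snoc B) τ) :
    T.IsSub Δ (Γ.snoc (hS.Sig A B)) (hS.pairSub A B τ) := by
  obtain ⟨hτ₁, h₀⟩ := isSub_snoc.1 hτ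
  obtain ⟨hτ₂, h₁⟩ := isSub_snoc.1 hτ₁
  refine hτ₂.cons ?_
  rw [hS.Sig_sub]
  rw [← Expr.sub_up_tail_sub_inst] at h₀
  exact hS.pair_intro (der_sub hΔ hτ₂ hB.init.isTy) (isTy_sub_up hΔ hB hτ₂) h₁ h₀

theorem isSub_unpairSub {τ : Sub T.sig (n + 1) m} (hτ : T.IsSub Δ (Γ.snoc (hS.Sig A B)) τ) :
    T.IsSub Δ ((Γ.snoc A).snoc B) (hS.unpairSub A B τ) := by
  obtain ⟨hτ₁, h₀⟩ := isSub_snoc.1 hτ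
  rw [hS.Sig_sub] at h₀
  have hA' := der_sub hΔ hτ₁ hB.init.isTy
  have hB' := isTy_sub_up hΔ hB hτ₁
  refine (hτ₁.cons (hS.fst_elim hA' hB' h₀)).cons ?_
  rw [← Expr.sub_up_sub_inst]
  exact hS.snd_elim hA' hB' h₀

theorem eqSub_unpairSub_pairSub {τ : Sub T.sig (n + 2) m}
    (hτ : T.IsSub Δ ((Γ.snoc A).snoc B) τ) :
    T.EqSub Δ ((Γ.snoc A).snoc B) τ (hS.unpairSub A B (hS.pairSub A B τ)) := by
  obtain ⟨hτ₁, h₀⟩ := isSub_snoc.1 hτ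
  obtain ⟨hτ₂, h₁⟩ := isSub_snoc.1 hτ₁
  have hA' := der_sub hΔ hτ₂ hB.init.isTy
  have hB' := isTy_sub_up hΔ hB hτ₂
  rw [← Expr.sub_up_tail_sub_inst] at h₀
  refine eqSub_snoc.2 ⟨eqSub_snoc.2 ⟨eqSub_refl hτ₂, ?_⟩, ?_⟩
  · exact .tm_symm (hS.fst_pair hA' hB' h₁ h₀)
  · rw [← Expr.sub_up_tail_sub_inst]
    exact .tm_symm (hS.snd_pair hA' hB' h₁ h₀)

theorem eqSub_pairSub_unpairSub {τ : Sub T.sig (n + 1) m}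
    (hτ : T.IsSub Δ (Γ.snoc (hS.Sig A B)) τ) :
    T.EqSub Δ (Γ.snoc (hS.Sig A B)) τ (hS.pairSub A B (hS.unpairSub A B τ)) := by
  obtain ⟨hτ₁, h₀⟩ := isSub_snoc.1 hτ
  refine eqSub_snoc.2 ⟨eqSub_refl hτ₁, ?_⟩
  rw [hS.Sig_sub] at h₀ ⊢
  exact .tm_symm (hS.pair_eta (der_sub hΔ hτ₁ hB.init.isTy) (isTy_sub_up hΔ hB hτ₁) h₀)

end

theorem exists_iso_snoc_Sig {hA : T.Wf (Γ.snoc A)} (hB : T.Wf ((Γ.snoc A).snoc B)) :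
    ∃ (h : T.Wf (Γ.snoc (hS.Sig A B))) (e : ob _ hB ≅ ob _ h),
      e.hom ≫ display hA.init h = display hA hB ≫ display hA.init hA := by
  have h : T.Wf (Γ.snoc (hS.Sig A B)) := .snoc hA.init (hS.Sig_form hA.isTy hB.isTy)
  have hpair := hS.isSub_pairSub hB hB (isSub_id hB)
  have hunpair := hS.isSub_unpairSub h hB (isSub_id h)
  refine ⟨h, ⟨homOf hB h _ hpair, homOf h hB _ hunpair, ?_, ?_⟩, rfl⟩
  · refine (homOf_eq_homOf_iff.2 (?_ : T.EqSub ((Γ.snoc A).snoc B) _ (Sub.id (n + 2))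
      (Sub.comp (hS.unpairSub A B (Sub.id _)) (hS.pairSub A B (Sub.id _))))).symm
    rw [comp_unpairSub]
    exact hS.eqSub_unpairSub_pairSub hB hB (isSub_id hB)
  · refine (homOf_eq_homOf_iff.2 (?_ : T.EqSub (Γ.snoc (hS.Sig A B)) _ (Sub.id (n + 1))
      (Sub.comp (hS.pairSub A B (Sub.id _)) (hS.unpairSub A B (Sub.id _))))).symm
    rw [comp_pairSub]
    exact hS.eqSub_pairSub_unpairSub h hB (isSub_id h)

end StrongSums

/-- A presentation of a morphism of the classifying category as a display map
`[Γ, x ∈ A] → Γ`, up to isomorphism of arrows. -/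
structure DisplayPresentation {X I : T.ClassifyingCat} (α : X ⟶ I) where
  {len : ℕ}
  {Γ : Ctx T.sig len}
  {A : Ty T.sig len}
  wf : T.Wf (Γ.snoc A)
  base : I ≅ ob Γ wf.init
  total : X ≅ ob (Γ.snoc A) wf
  comm : total.hom ≫ display wf.init wf = α ≫ base.hom

namespace DisplayPresentation

variable {X Y I J : T.ClassifyingCat} {α : X ⟶ I} {β : Y ⟶ J}

theorem isPullback (R : DisplayPresentation α) :
    IsPullback R.total.hom α (display R.wf.init R.wf) R.base.hom :=
  .of_horiz_isIso ⟨R.comm⟩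

/-- The presentation given by an isomorphism over a context with a one-variable extension. -/
def ofIsoOver {Δ : Ctx T.sig m} {A : Ty T.sig m} {hA : T.Wf (Δ.snoc A)} {α : X ⟶ ob Δ hA.init}
    (e : X ≅ ob (Δ.snoc A) hA) (h : e.hom ≫ display hA.init hA = α) : DisplayPresentation α where
  wf := hA
  base := Iso.refl _
  total := e
  comm := by rw [h, Iso.refl_hom, Category.comp_id]

/-- Presentations are invariant under isomorphism of arrows. -/
def ofIso (R : DisplayPresentation α) (a : Y ≅ X) (b : J ≅ I) (h : a.hom ≫ α = β ≫ b.hom) :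
    DisplayPresentation β where
  wf := R.wf
  base := b ≪≫ R.base
  total := a ≪≫ R.total
  comm := by rw [Iso.trans_hom, Iso.trans_hom, Category.assoc, R.comm, reassoc_of% h]

theorem fibrations (R : DisplayPresentation α) : T.fibrations α := by
  have hdisplay : T.fibrations (display R.wf.init R.wf) := by
    refine MorphismProperty.le_isoClosure _ _ ?_
    rw [← Category.comp_id (display R.wf.init R.wf)]
    exact .display_comp R.wf.init R.wf _ (.id _)
  exact (MorphismProperty.arrow_mk_iso_iff (MorphismProperty.isoClosure _)
    (Arrow.isoMk R.total R.base R.comm)).2 hdisplay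

theorem exists_iso_of_isPullback {Δ : Ctx T.sig m} {hΔ : T.Wf Δ} {α' : Y ⟶ ob Δ hΔ} {κ' : Y ⟶ X}
    {κ : ob Δ hΔ ⟶ I} (R : DisplayPresentation α) (h : IsPullback κ' α' α κ) {σ : Sub T.sig R.len m}
    (hσ : T.IsSub Δ R.Γ σ) (hκ : κ ≫ R.base.hom = homOf hΔ R.wf.init σ hσ) :
    ∃ e : Y ≅ ob (Δ.snoc (R.A.sub σ)) (R.wf.snoc_sub hΔ hσ),
      e.hom ≫ display hΔ (R.wf.snoc_sub hΔ hσ) = α' ∧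
      e.hom ≫ homOf (R.wf.snoc_sub hΔ hσ) R.wf σ.up (hσ.up_of_eq (R.wf.snoc_sub hΔ hσ) rfl) =
        κ' ≫ R.total.hom := by
  have hα' := h.paste_horiz R.isPullback
  rw [hκ] at hα'
  have hσ' := isPullback_display (hA := R.wf) (hB := R.wf.snoc_sub hΔ hσ) hσ rfl
  exact ⟨hα'.isoIsPullback _ _ hσ', hα'.isoIsPullback_hom_snd _ _ hσ',
    hα'.isoIsPullback_hom_fst _ _ hσ'⟩

theorem exists_iso_over {Δ : Ctx T.sig m} {hΔ : T.Wf Δ} {α : X ⟶ ob Δ hΔ}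
    (R : DisplayPresentation α) :
    ∃ (A : Ty T.sig m) (hA : T.Wf (Δ.snoc A)) (e : X ≅ ob (Δ.snoc A) hA),
      e.hom ≫ display hΔ hA = α := by
  obtain ⟨σ, hσ, h⟩ := exists_eq_homOf R.base.hom
  obtain ⟨e, he, -⟩ := R.exists_iso_of_isPullback (.id_horiz α) hσ ((Category.id_comp _).trans h)
  exact ⟨_, _, e, he⟩

theorem exists_isPullback (R : DisplayPresentation α) (f : J ⟶ I) :
    ∃ (Y : T.ClassifyingCat) (α' : Y ⟶ J) (f' : Y ⟶ X),
      IsPullback f' α' α f ∧ Nonempty (DisplayPresentation α') := by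
  induction J using ClassifyingCat.ind with
  | _ Δ hΔ =>
  obtain ⟨σ, hσ, h⟩ := exists_eq_homOf (f ≫ R.base.hom)
  have hσ' := isPullback_display (hA := R.wf) (hB := R.wf.snoc_sub hΔ hσ) hσ rfl
  rw [← h] at hσ'
  exact ⟨_, _, _, .of_right' hσ' R.isPullback, ⟨ofIsoOver (Iso.refl _) (Category.id_comp _)⟩⟩

variable (hS : T.StrongSums)
include hS

theorem nonempty_id (X : T.ClassifyingCat) : Nonempty (DisplayPresentation (𝟙 X)) := by
  induction X using ClassifyingCat.ind with
  | _ Γ hΓ =>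
  obtain ⟨h, e, he⟩ := hS.exists_iso_snoc_unit hΓ
  exact ⟨ofIsoOver e he⟩

theorem nonempty_comp {Z : T.ClassifyingCat} {f : X ⟶ Y} {g : Y ⟶ Z}
    (Rf : DisplayPresentation f) (Rg : DisplayPresentation g) :
    Nonempty (DisplayPresentation (f ≫ g)) := by
  obtain ⟨B, hB, e, he⟩ := (Rf.ofIso (β := f ≫ Rg.total.hom) (Iso.refl _) Rg.total.symm
    (by simp)).exists_iso_over
  obtain ⟨h, e', he'⟩ := hS.exists_iso_snoc_Sig hB
  refine ⟨⟨h, Rg.base, e ≪≫ e', ?_⟩⟩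
  rw [Iso.trans_hom, Category.assoc, he', reassoc_of% he, Rg.comm, Category.assoc]

theorem nonempty_of_isDepProj {f : X ⟶ Y} (hf : IsDepProj f) :
    Nonempty (DisplayPresentation f) := by
  induction hf with
  | id X => exact nonempty_id hS X
  | display_comp _ _ _ _ ih =>
    exact nonempty_comp hS (ofIsoOver (Iso.refl _) (Category.id_comp _)) ih.some

end DisplayPresentation

theorem exists_isDepProj_nil {Γ : Ctx T.sig n} (hΓ : T.Wf Γ) :
    ∃ f : ob Γ hΓ ⟶ ob Ctx.nil .nil, IsDepProj f := by
  induction hΓ with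
  | nil => exact ⟨_, .id _⟩
  | snoc hΓ hA ih =>
    obtain ⟨f, hf⟩ := ih
    exact ⟨_, .display_comp hΓ (.snoc hΓ hA) f hf⟩

theorem nonempty_isTerminal_nil : Nonempty (IsTerminal (ob (T := T) Ctx.nil .nil)) := by
  have hhom (X : T.ClassifyingCat) : Nonempty (Unique (X ⟶ ob (T := T) Ctx.nil .nil)) := by
    induction X using ClassifyingCat.ind with
    | _ Γ hΓ =>
    refine ⟨⟨⟨homOf hΓ .nil (fun i => i.elim0) fun i => i.elim0⟩, fun f => ?_⟩⟩
    obtain ⟨σ, hσ, rfl⟩ := exists_eq_homOf f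
    exact homOf_eq_homOf_iff.2 fun i => i.elim0
  exact ⟨@IsTerminal.ofUnique _ _ _ fun X => (hhom X).some⟩

section

variable (hS : T.StrongSums) {X Y : T.ClassifyingCat}
include hS

theorem fibrations_iff_nonempty_displayPresentation {f : X ⟶ Y} :
    T.fibrations f ↔ Nonempty (DisplayPresentation f) := by
  refine ⟨fun ⟨X', Y', g, hg, ⟨e⟩⟩ => ?_, fun ⟨R⟩ => R.fibrations⟩
  obtain ⟨R⟩ := DisplayPresentation.nonempty_of_isDepProj hS hg
  exact ⟨R.ofIso (Arrow.leftFunc.mapIso e.symm) (Arrow.rightFunc.mapIso e.symm) e.inv.w⟩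

theorem isTribe_fibrations : IsTribe T.fibrations where
  hasTerminal := nonempty_isTerminal_nil.some.hasTerminal
  iso_mem {X Y} f hf := by
    obtain ⟨R⟩ := DisplayPresentation.nonempty_id hS X
    exact (R.ofIso (Iso.refl X) (asIso f).symm (by simp)).fibrations
  comp_mem f g hf hg := by
    obtain ⟨Rf⟩ := (fibrations_iff_nonempty_displayPresentation hS).1 hf
    obtain ⟨Rg⟩ := (fibrations_iff_nonempty_displayPresentation hS).1 hg
    exact (fibrations_iff_nonempty_displayPresentation hS).2
      (DisplayPresentation.nonempty_comp hS Rf Rg)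
  toTerminal_mem {X Z} hZ f := by
    induction X using ClassifyingCat.ind with
    | _ Γ hΓ =>
    obtain ⟨g, hg⟩ := exists_isDepProj_nil hΓ
    obtain ⟨R⟩ := DisplayPresentation.nonempty_of_isDepProj hS hg
    obtain ⟨hnil⟩ := nonempty_isTerminal_nil (T := T)
    exact (R.ofIso (Iso.refl _) (hZ.uniqueUpToIso hnil) (hnil.hom_ext _ _)).fibrations
  pullback p f hp := by
    obtain ⟨R⟩ := (fibrations_iff_nonempty_displayPresentation hS).1 hp
    obtain ⟨Y', q, f', h, ⟨R'⟩⟩ := R.exists_isPullback f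
    exact ⟨Y', q, f', h, R'.fibrations⟩

end

section IdentityContexts

theorem comp_up_inst₃ (σ : Sub T.sig n m) (a b p : Tm T.sig m) :
    Sub.comp σ.up.up.up (T.inst₃ a b p) = Sub.cons p (Sub.cons b (Sub.cons a σ)) := by
  rw [inst₃, Sub.up_comp_cons, Sub.up_comp_cons, Sub.up_comp_cons, Sub.comp_id]

namespace IdFormers

variable (F : T.IdFormers)

theorem Id_wk_sub (A : Ty T.sig n) (σ : Sub T.sig n m) :
    (F.Id A.wk.wk (.var 1) (.var 0)).sub σ.up.up =
      F.Id (A.sub σ).wk.wk (.var 1) (.var 0) := by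
  rw [F.Id_sub, Expr.sub_wk, Expr.sub_wk]
  rfl

theorem comp_up_diag (A : Ty T.sig n) (σ : Sub T.sig n m) :
    Sub.comp σ.up.up.up (F.diag (A.sub σ)) = Sub.comp (F.diag A) σ.up := by
  rw [diag, diag, Sub.up_comp_cons, Sub.up_comp_cons, Sub.comp_id, Sub.cons_comp, Sub.cons_comp,
    F.r_sub, ← Expr.sub_wk]
  rfl

theorem cons_r_proj (A : Ty T.sig n) :
    Sub.cons (F.r (A.sub (Sub.proj n)) (.var 0)) (Sub.cons (.var 0)
      (Sub.cons (.var 0) (Sub.proj n))) = F.diag A := by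
  rw [Sub.cons_var_zero_proj, ← wk_eq_sub]
  rfl

end IdFormers

namespace PropIdTypes

variable {k : ℕ} (hId : T.PropIdTypes) {Γ : Ctx T.sig n} {Δ : Ctx T.sig m} {A : Ty T.sig n}
  {Θ : Tel T.sig (n + 3) k} {C : Ty T.sig (ext (n + 3) k)} {d : Tm T.sig (ext (n + 1) k)}
  {σ : Sub T.sig n m}

theorem wf_idCtx (hA : T.Wf (Γ.snoc A)) : T.Wf (hId.idCtx Γ A) :=
  have h := hA.snoc_wk
  .snoc h (hId.formation (wf_type h 1) (h.hasTy_var 1) (h.hasTy_var 0))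

theorem isSub_diag (hA : T.Wf (Γ.snoc A)) : T.IsSub (Γ.snoc A) (hId.idCtx Γ A) (hId.diag A) := by
  have hx := Derivable.ax hA.isTy
  refine ((isSub_id hA).cons (by rwa [Expr.sub_id])).cons ?_
  have hr := hId.introduction hA.isTy_wk hx
  rw [hId.Id_sub, Expr.wk_sub_cons, Expr.sub_id]
  exact hr

theorem isSub_idCtx (hΔ : T.Wf Δ) (hσ : T.IsSub Δ Γ σ) (hA : T.Wf (Γ.snoc A)) :
    T.IsSub (hId.idCtx Δ (A.sub σ)) (hId.idCtx Γ A) σ.up.up.up :=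
  have hB := hA.snoc_sub hΔ hσ
  ((hσ.up_of_eq hB rfl).up_of_eq hB.snoc_wk (Expr.sub_wk A σ)).up_of_eq
    (hId.wf_idCtx hB) (hId.Id_wk_sub A σ).symm

variable (A Θ C d σ) in
/-- The eliminator `J` whose type, motive and base case are given over a context `Γ` and used over
a context `Δ` along `σ : Δ ⟶ Γ`. -/
def elim (a b p : Tm T.sig m) : Tm T.sig (ext m k) :=
  hId.J (A.sub σ) (Θ.sub σ.up.up.up) (C.sub (.upN k σ.up.up.up)) a b p (d.sub (.upN k σ.up))

theorem elim_sub (a b p : Tm T.sig m) (τ : Sub T.sig m l) :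
    (hId.elim A Θ C d σ a b p).sub (.upN k τ) =
      hId.elim A Θ C d (Sub.comp σ τ) (a.sub τ) (b.sub τ) (p.sub τ) := by
  simp only [elim, hId.J_sub, ← Sub.up_comp_up, ← upN_comp, ← Expr.sub_sub, ← Tel.sub_sub]

section Eliminators

variable (hΔ : T.Wf Δ) (hσ : T.IsSub Δ Γ σ) (hA : T.Wf (Γ.snoc A))
  (hC : T.Der ((hId.idCtx Γ A).append Θ) (.isTy C))
  (hd : T.Der ((Γ.snoc A).append (Θ.sub (hId.diag A))) (.hasTy d (C.sub (.upN k (hId.diag A)))))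

include hΔ hσ hA

include hC in
theorem isTy_motive_sub :
    T.Der ((hId.idCtx Δ (A.sub σ)).append (Θ.sub σ.up.up.up))
      (.isTy (C.sub (.upN k σ.up.up.up))) :=
  der_sub_tel (hId.wf_idCtx (hA.snoc_sub hΔ hσ)) _ Θ (.isTy C) _ (hId.isSub_idCtx hΔ hσ hA) hC

include hd in
theorem hasTy_base_sub :
    T.Der ((Δ.snoc (A.sub σ)).append ((Θ.sub σ.up.up.up).sub (hId.diag (A.sub σ))))
      (.hasTy (d.sub (.upN k σ.up))
        ((C.sub (.upN k σ.up.up.up)).sub (.upN k (hId.diag (A.sub σ))))) := by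
  rw [Tel.sub_sub, Expr.sub_sub, upN_comp, hId.comp_up_diag, ← upN_comp, ← Tel.sub_sub,
    ← Expr.sub_sub]
  exact der_sub_tel (hA.snoc_sub hΔ hσ) _ _ (.hasTy d _) _
    (hσ.up_of_eq (hA.snoc_sub hΔ hσ) rfl) hd

include hC hd

theorem hasTy_elim {a b p : Tm T.sig m} (ha : T.Der Δ (.hasTy a (A.sub σ)))
    (hb : T.Der Δ (.hasTy b (A.sub σ))) (hp : T.Der Δ (.hasTy p (hId.Id (A.sub σ) a b))) :
    T.Der (Δ.append (Θ.sub (Sub.cons p (Sub.cons b (Sub.cons a σ)))))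
      (.hasTy (hId.elim A Θ C d σ a b p)
        (C.sub (.upN k (Sub.cons p (Sub.cons b (Sub.cons a σ)))))) := by
  rw [← comp_up_inst₃, ← upN_comp, ← Tel.sub_sub, ← Expr.sub_sub]
  exact hId.elimination (hId.isTy_motive_sub hΔ hσ hA hC) ha hb hp
    (hId.hasTy_base_sub hΔ hσ hA hd)

theorem exists_hasTy_Id_elim_r {a : Tm T.sig m} (ha : T.Der Δ (.hasTy a (A.sub σ))) :
    ∃ h, T.Der (Δ.append (Θ.sub (Sub.cons (hId.r (A.sub σ) a) (Sub.cons a (Sub.cons a σ)))))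
      (.hasTy h (hId.Id
        (C.sub (.upN k (Sub.cons (hId.r (A.sub σ) a) (Sub.cons a (Sub.cons a σ)))))
        (hId.elim A Θ C d σ a a (hId.r (A.sub σ) a)) (d.sub (.upN k (Sub.cons a σ))))) := by
  rw [← comp_up_inst₃, ← upN_comp, ← Tel.sub_sub, ← Expr.sub_sub, ← Sub.up_comp_inst σ a,
    ← upN_comp, ← Expr.sub_sub]
  exact ⟨_, hId.computation (hId.isTy_motive_sub hΔ hσ hA hC) ha
    (hId.hasTy_base_sub hΔ hσ hA hd)⟩

end Eliminators

theorem hasTy_elim_universal (hA : T.Wf (Γ.snoc A))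
    (hC : T.Der ((hId.idCtx Γ A).append Θ) (.isTy C))
    (hd : T.Der ((Γ.snoc A).append (Θ.sub (hId.diag A)))
      (.hasTy d (C.sub (.upN k (hId.diag A))))) :
    T.Der ((hId.idCtx Γ A).append Θ)
      (.hasTy (hId.elim A Θ C d (fun i => .var i.succ.succ.succ) (.var 2) (.var 1) (.var 0))
        C) := by
  have hw := hId.wf_idCtx hA
  have hxy := isSub_snoc.1 (isSub_snoc.1 (isSub_id hw)).1
  have hx := isSub_snoc.1 hxy.1
  have hy := hxy.2
  have hu := (isSub_snoc.1 (isSub_id hw)).2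
  rw [Expr.wk_sub] at hy
  rw [hId.Id_sub, Expr.wk_sub, Expr.wk_sub] at hu
  have hvars : Sub.cons (.var 0) (Sub.cons (.var 1) (Sub.cons (.var 2)
      fun i : Fin n => .var i.succ.succ.succ)) = Sub.id (S := T.sig) (n + 3) := by
    funext i
    refine Fin.cases rfl (fun i => Fin.cases rfl (fun i => Fin.cases rfl (fun i => rfl) i) i) i
  have h := hId.hasTy_elim (a := .var 2) (b := .var 1) (p := .var 0)
    (σ := fun i : Fin n => .var i.succ.succ.succ) hw hx.1 hA hC hd hx.2 hy hu
  rw [hvars, upN_id, Expr.sub_id, Tel.sub_id] at h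
  exact h

theorem exists_universal_elim (hA : T.Wf (Γ.snoc A))
    (hC : T.Der ((hId.idCtx Γ A).append Θ) (.isTy C))
    (hd : T.Der ((Γ.snoc A).append (Θ.sub (hId.diag A)))
      (.hasTy d (C.sub (.upN k (hId.diag A))))) :
    ∃ (j : Tm T.sig (ext (n + 3) k)) (h : Tm T.sig (ext (n + 1) k)),
      T.Der ((hId.idCtx Γ A).append Θ) (.hasTy j C) ∧
      T.Der ((Γ.snoc A).append (Θ.sub (hId.diag A)))
        (.hasTy h (hId.Id (C.sub (.upN k (hId.diag A))) (j.sub (.upN k (hId.diag A))) d)) := by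
  have hx : T.Der (Γ.snoc A) (.hasTy (.var 0) (A.sub (Sub.proj n))) := by
    rw [← wk_eq_sub]
    exact hA.hasTy_var 0
  obtain ⟨h, hh⟩ := hId.exists_hasTy_Id_elim_r hA (isSub_proj hA) hA hC hd hx
  rw [hId.cons_r_proj, Sub.cons_var_zero_proj, upN_id, Expr.sub_id] at hh
  refine ⟨_, h, hId.hasTy_elim_universal hA hC hd, ?_⟩
  rw [hId.elim_sub]
  change T.Der _ (.hasTy h (hId.Id _ (hId.elim A Θ C d (Sub.proj n) (.var 0) (.var 0)
    (hId.r A.wk (.var 0))) d))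
  rw [wk_eq_sub]
  exact hh

end PropIdTypes

variable {Γ : Ctx T.sig n} {Δ : Ctx T.sig m} {Ξ : Ctx T.sig l} {A : Ty T.sig n} {C : Ty T.sig l}
  {σ : Sub T.sig n m}

instance : T.fibrations.RespectsIso :=
  inferInstanceAs (MorphismProperty.isoClosure _).RespectsIso

section

variable (hA : T.Wf (Γ.snoc A))

/-- The second projection `[Γ, x ∈ A, y ∈ A] → [Γ, y ∈ A]`. -/
def display₂ : ob ((Γ.snoc A).snoc A.wk) hA.snoc_wk ⟶ ob (Γ.snoc A) hA :=
  homOf hA.snoc_wk hA (Sub.proj n).up ((isSub_proj hA).up_of_eq hA.snoc_wk (wk_eq_sub A))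

theorem isPullback_display₂ :
    IsPullback (display hA hA.snoc_wk) (display₂ hA) (display hA.init hA) (display hA.init hA) :=
  (isPullback_display (isSub_proj hA) (wk_eq_sub A)).flip

end

theorem homOf_up_up_comp_display₂ {hA : T.Wf (Γ.snoc A)} {hB : T.Wf (Δ.snoc (A.sub σ))}
    (hσ : T.IsSub Δ Γ σ) :
    homOf hB.snoc_wk hA.snoc_wk σ.up.up
        ((hσ.up_of_eq hB rfl).up_of_eq hB.snoc_wk (Expr.sub_wk A σ)) ≫ display₂ hA =
      display₂ hB ≫ homOf hB hA σ.up (hσ.up_of_eq hB rfl) :=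
  homOf_congr (by
    change Sub.comp (Sub.proj n).up σ.up.up = Sub.comp σ.up (Sub.proj m).up
    rw [Sub.up_comp_up, Sub.up_comp_up, Sub.proj_comp_up])

namespace PropIdTypes

variable (hId : T.PropIdTypes)

section

variable (hA : T.Wf (Γ.snoc A))

/-- The projection `[Γ, x ∈ A, y ∈ A, u ∈ Id_A(x, y)] → [Γ, x ∈ A, y ∈ A]`. -/
def idDisplay :
    ob (hId.idCtx Γ A) (hId.wf_idCtx hA) ⟶ ob ((Γ.snoc A).snoc A.wk) hA.snoc_wk :=
  display hA.snoc_wk (hId.wf_idCtx hA)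

/-- The morphism `[Γ, x ∈ A] → [Γ, x ∈ A, y ∈ A, u ∈ Id_A(x, y)]` given by `x, x, r(x)`. -/
def idRefl : ob (Γ.snoc A) hA ⟶ ob (hId.idCtx Γ A) (hId.wf_idCtx hA) :=
  homOf hA (hId.wf_idCtx hA) (hId.diag A) (hId.isSub_diag hA)

theorem idRefl_comp_idDisplay_comp_display₂ :
    hId.idRefl hA ≫ hId.idDisplay hA ≫ display₂ hA = 𝟙 _ :=
  homOf_congr (τ := Sub.id (n + 1)) (hτ := isSub_id hA)
    (funext fun i => Fin.cases rfl (fun _ => rfl) i)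

/-- The identity context `[Γ, x ∈ A, y ∈ A, u ∈ Id_A(x, y)]` as a path object of
`[Γ, x ∈ A] → Γ`. -/
def displayPath : PathFactorisation T.fibrations (display hA.init hA) :=
  .ofIsPullback (ob (hId.idCtx Γ A) (hId.wf_idCtx hA)) (hId.idRefl hA)
    (hId.idDisplay hA ≫ display hA hA.snoc_wk) (hId.idDisplay hA ≫ display₂ hA)
    (by rw [Category.assoc, Category.assoc, (isPullback_display₂ hA).w])
    rfl (hId.idRefl_comp_idDisplay_comp_display₂ hA) (isPullback_display₂ hA) (by
      convert (DisplayPresentation.ofIsoOver (α := hId.idDisplay hA) (Iso.refl _)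
        (Category.id_comp _)).fibrations using 1
      apply (isPullback_display₂ hA).hom_ext <;> simp)

end

theorem isSub_idCtx_cons {ρ : Sub T.sig l m} (hρ : T.IsSub Δ Ξ ρ)
    {a b p : Tm T.sig m} (ha : T.Der Δ (.hasTy a (C.sub ρ))) (hb : T.Der Δ (.hasTy b (C.sub ρ)))
    (hp : T.Der Δ (.hasTy p (hId.Id (C.sub ρ) a b))) :
    T.IsSub Δ (hId.idCtx Ξ C) (Sub.cons p (Sub.cons b (Sub.cons a ρ))) := by
  refine ((hρ.cons ha).cons ?_).cons ?_
  · rwa [Expr.wk_sub_cons]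
  · rw [hId.Id_sub, Expr.wk_sub_cons, Expr.wk_sub_cons]
    exact hp

theorem exists_path {hΔ : T.Wf Δ} (hC : T.Wf (Ξ.snoc C)) {ρ : Sub T.sig l m}
    (hρ : T.IsSub Δ Ξ ρ) {a b p : Tm T.sig m} (ha : T.Der Δ (.hasTy a (C.sub ρ)))
    (hb : T.Der Δ (.hasTy b (C.sub ρ)))
    (hp : T.Der Δ (.hasTy p (hId.Id (C.sub ρ) a b))) :
    ∃ H : ob Δ hΔ ⟶ (hId.displayPath hC).P,
      H ≫ (hId.displayPath hC).s = homOf hΔ hC (Sub.cons a ρ) (hρ.cons ha) ∧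
      H ≫ (hId.displayPath hC).t = homOf hΔ hC (Sub.cons b ρ) (hρ.cons hb) := by
  refine ⟨homOf hΔ (hId.wf_idCtx hC) _ (hId.isSub_idCtx_cons hρ ha hb hp), rfl, homOf_congr ?_⟩
  funext i
  refine Fin.cases rfl (fun _ => rfl) i

theorem hasWeakLifts_displayPath {B : Ty T.sig (n + 3)} (hA : T.Wf (Γ.snoc A))
    (hB : T.Wf ((hId.idCtx Γ A).snoc B)) (hC : T.Wf (Ξ.snoc C)) :
    (hId.displayPath hC).HasWeakLifts
      (homOf (hB.snoc_sub hA (hId.isSub_diag hA)) hB (hId.diag A).up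
        ((hId.isSub_diag hA).up_of_eq (hB.snoc_sub hA (hId.isSub_diag hA)) rfl)) := by
  intro k l h
  obtain ⟨ρ, hρ, rfl⟩ := exists_eq_homOf l
  have hB' := hB.snoc_sub hA (hId.isSub_diag hA)
  have hg := (hId.isSub_diag hA).up_of_eq hB' rfl
  obtain ⟨t, ht, rfl⟩ := exists_eq_homOf_cons (isSub_comp hB' hg hρ) h
  obtain ⟨j, p, hj, hp⟩ := hId.exists_universal_elim (k := 1) (Θ := .cons B .nil) hA
    (der_sub hB hρ hC.isTy) (by rw [Expr.sub_sub]; exact ht)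
  have hj' := der_sub hB' hg hj
  obtain ⟨H, hs, ht⟩ := hId.exists_path (hΔ := hB') hC (isSub_comp hB' hg hρ)
    (by rw [← Expr.sub_sub]; exact hj') ht (by rw [← Expr.sub_sub]; exact hp)
  exact ⟨homOf hB hC (Sub.cons j ρ) (hρ.cons hj), H, rfl,
    hs.trans (homOf_congr (Sub.cons_comp j ρ _).symm), ht⟩

theorem isBaseChange_displayPath (hΔ : T.Wf Δ) (hσ : T.IsSub Δ Γ σ) (hA : T.Wf (Γ.snoc A)) :
    have hB := hA.snoc_sub hΔ hσ
    (hId.displayPath hA).IsBaseChange (homOf hB hA σ.up (hσ.up_of_eq hB rfl)) (display hΔ hB)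
      (homOf hΔ hA.init σ hσ)
      (homOf (hId.wf_idCtx hB) (hId.wf_idCtx hA) σ.up.up.up (hId.isSub_idCtx hΔ hσ hA))
      (hId.displayPath hB).s (hId.displayPath hB).t := by
  intro hB
  have h₁ := isPullback_display (hA := hA) (hB := hB) hσ rfl
  have h₂ := isPullback_display (hA := hA.snoc_wk) (hB := hB.snoc_wk) (hσ.up_of_eq hB rfl)
    (Expr.sub_wk A σ)
  have h₃ := isPullback_display (hA := hId.wf_idCtx hA) (hB := hId.wf_idCtx hB)
    ((hσ.up_of_eq hB rfl).up_of_eq hB.snoc_wk (Expr.sub_wk A σ)) (hId.Id_wk_sub A σ).symm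
  have h₃₂ := h₃.paste_vert h₂
  refine ⟨h₁, h₃₂.paste_vert h₁, (hId.displayPath hB).w, h₃₂.w.symm, ?_⟩
  change (hId.idDisplay hB ≫ display₂ hB) ≫ _ = _ ≫ hId.idDisplay hA ≫ display₂ hA
  rw [Category.assoc, ← homOf_up_up_comp_display₂ hσ]
  exact (h₃.w_assoc _).symm

end PropIdTypes

end IdentityContexts

namespace DisplayPresentation

variable {X Y D I J U V X' Q : T.ClassifyingCat} {α : X ⟶ I} {f : Y ⟶ D}
  (hId : T.PropIdTypes)

/-- The path object of a presented morphism, given by the identity context of its presentation. -/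
def pathFactorisation (R : DisplayPresentation α) : PathFactorisation T.fibrations α :=
  (hId.displayPath R.wf).ofIso R.total R.base R.comm

theorem hasWeakLifts (R : DisplayPresentation α) (R' : DisplayPresentation f)
    {q : U ⟶ (R.pathFactorisation hId).P} (Rq : DisplayPresentation q) {g : V ⟶ U} {q' : V ⟶ X}
    (h : IsPullback g q' q (R.pathFactorisation hId).r) :
    (R'.pathFactorisation hId).HasWeakLifts g := by
  have hA := R.wf
  obtain ⟨B, hB, eU, heU⟩ := exists_iso_over (hΔ := hId.wf_idCtx hA) Rq
  have hD := isPullback_display (hA := hB) (hB := hB.snoc_sub hA (hId.isSub_diag hA))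
    (hId.isSub_diag hA) rfl
  have hV : IsPullback (g ≫ eU.hom) (q' ≫ R.total.hom) (display (hId.wf_idCtx hA) hB)
      (hId.idRefl hA) :=
    .of_iso h (Iso.refl V) eU R.total (Iso.refl _) (by simp) (by simp)
      ((Category.comp_id q).trans heU.symm) (Category.comp_id _)
  exact ((hId.hasWeakLifts_displayPath hA hB R'.wf).ofIso R'.total R'.base R'.comm).of_arrow_iso
    (hV.isoIsPullback _ _ hD) eU (hV.isoIsPullback_hom_fst _ _ hD)

theorem exists_isBaseChange (R : DisplayPresentation α) {κ : J ⟶ I} {κ' : X' ⟶ X} {α' : X' ⟶ J}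
    (h : IsPullback κ' α' α κ) :
    ∃ (R' : DisplayPresentation α')
      (e : (R'.pathFactorisation hId).P ⟶ (R.pathFactorisation hId).P),
      (R.pathFactorisation hId).IsBaseChange κ' α' κ e (R'.pathFactorisation hId).s
        (R'.pathFactorisation hId).t := by
  induction J using ClassifyingCat.ind with
  | _ Δ hΔ =>
  obtain ⟨σ, hσ, hκ⟩ := exists_eq_homOf (κ ≫ R.base.hom)
  obtain ⟨a, ha, haκ⟩ := R.exists_iso_of_isPullback h hσ hκ
  exact ⟨ofIsoOver a ha, _, (hId.isBaseChange_displayPath hΔ hσ R.wf).ofIso R.total R.base R.comm a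
    ha haκ hκ⟩

variable (hS : T.StrongSums)
include hS

theorem exists_comparison (R R' : DisplayPresentation α) :
    ∃ φ : (R.pathFactorisation hId).P ⟶ (R'.pathFactorisation hId).P,
      φ ≫ (R'.pathFactorisation hId).s = (R.pathFactorisation hId).s ∧
      φ ≫ (R'.pathFactorisation hId).t = (R.pathFactorisation hId).t := by
  obtain ⟨Q, _, _, h, -⟩ := R.exists_isPullback α
  obtain ⟨Rst⟩ := (fibrations_iff_nonempty_displayPresentation hS).1
    ((R'.pathFactorisation hId).fib h)
  obtain ⟨Rid⟩ := nonempty_id hS (R.pathFactorisation hId).P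
  exact PathFactorisation.exists_comparison _ _ h (Rst.pathFactorisation hId)
    (R.hasWeakLifts hId Rst Rid (.of_vert_isIso (snd := 𝟙 X)
      ⟨by rw [Category.comp_id, Category.id_comp]⟩))

theorem exists_maps_of_isBaseChange (R : DisplayPresentation α) {κ : J ⟶ I} {κ' : X' ⟶ X}
    {α' : X' ⟶ J} (R' : DisplayPresentation α') {e : Q ⟶ (R.pathFactorisation hId).P}
    {s' t' : Q ⟶ X'} (h : (R.pathFactorisation hId).IsBaseChange κ' α' κ e s' t') :
    (∃ φ : (R'.pathFactorisation hId).P ⟶ Q, φ ≫ s' = (R'.pathFactorisation hId).s ∧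
      φ ≫ t' = (R'.pathFactorisation hId).t) ∧
    (∃ ψ : Q ⟶ (R'.pathFactorisation hId).P, ψ ≫ (R'.pathFactorisation hId).s = s' ∧
      ψ ≫ (R'.pathFactorisation hId).t = t') := by
  obtain ⟨R'', e'', h''⟩ := R.exists_isBaseChange hId h.isPullback
  obtain ⟨E, hEs, hEt⟩ := h.exists_iso h''
  obtain ⟨φ, hφs, hφt⟩ := R'.exists_comparison hId hS R''
  obtain ⟨ψ, hψs, hψt⟩ := R''.exists_comparison hId hS R'
  refine ⟨⟨φ ≫ E.inv, ?_, ?_⟩, ⟨E.hom ≫ ψ, ?_, ?_⟩⟩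
  · rw [← hEs, Category.assoc, Iso.inv_hom_id_assoc, hφs]
  · rw [← hEt, Category.assoc, Iso.inv_hom_id_assoc, hφt]
  · rw [Category.assoc, hψs, hEs]
  · rw [Category.assoc, hψt, hEt]

end DisplayPresentation

end TypeTheory

end DTT

theorem mainTheorem7 (T : DTT.TypeTheory.{u}) (hS : T.StrongSums) (hId : T.PropIdTypes) :
    DTT.IsTribe T.fibrations ∧ DTT.HasPropositionalIdentityTypes T.fibrations := by
  have presentation {X I : T.ClassifyingCat} (α : X ⟶ I) (hα : T.fibrations α) :=
    ((DTT.TypeTheory.fibrations_iff_nonempty_displayPresentation hS).1 hα).some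
  refine ⟨DTT.TypeTheory.isTribe_fibrations hS,
    fun α hα => (presentation α hα).pathFactorisation hId, ?_, ?_⟩
  · intro A I α hα U V q g q' hq hpb B D f hf k l h
    exact (presentation α hα).hasWeakLifts hId (presentation f hf) (presentation q hq) hpb k l h
  · intro A I J A' Q α hα κ κ' α' hα' e β s' t' hA hQ hs hsβ ht htβ
    subst hsβ
    exact (presentation α hα).exists_maps_of_isBaseChange hId hS (presentation α' hα')
      ⟨hA, hQ, htβ.symm, hs, ht⟩
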